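/- Let $\mathbf{u}=(u_1,u_2,u_3):\mathbb{R}\to\mathbb{S}^2\subset\mathbb{R}^3$ be a rational map, i.e. each $u_j$ is a quotient of real polynomials whose denominator has no real zero. Let $$\mathbf{U}=\begin{pmatrix} u_3 & u_1-\mathrm{i}u_2\\ u_1+\mathrm{i}u_2 & -u_3\end{pmatrix}:\mathbb{R}\to\mathbb{C}^{2\times 2}.$$ Let $L^2_+(\mathbb{R};\mathbb{C}^2)=\{f\in L^2(\mathbb{R};\mathbb{C}^2) : \mathrm{supp}\,\widehat f\subset[0,\infty)\}$ be the Hardy space and $L^2_-(\mathbb{R};\mathbb{C}^2)$ its orthogonal complement, and let $\Pi_-$ be the orthogonal projection of $L^2(\mathbb{R};\mathbb{C}^2)$ onto $L^2_-(\mathbb{R};\mathbb{C}^2)$. Define the Hankel operator $H_{\mathbf{U}}:L^2_+(\mathbb{R};\mathbb{C}^2)\to L^2_-(\mathbb{R};\mathbb{C}^2)$ by $H_{\mathbf{U}}f=\Pi_-(\mathbf{U}f)$, the operator $K_{\mathbf{U}}=H_{\mathbf{U}}^*H_{\mathbf{U}}$ on $L^2_+(\mathbb{R};\mathbb{C}^2)$,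 and $\mathfrak{H}_1=\overline{\mathrm{ran}(K_{\mathbf{U}})}$. Then, for every integer $N\ge 1$, the following statements are equivalent. (i) $\dim\mathfrak{H}_1=\mathrm{rank}(K_{\mathbf{U}})=N$. (ii) The least common denominator of $u_1,u_2,u_3$ in $\mathbb{R}[X]$ has degree $2N$. (iii) There is a rational function $R=P/Q\in\mathbb{C}(X)$, where $P\in\mathbb{C}[X]$ has degree $N$, $Q\in\mathbb{C}[X]$ is non-zero of degree at most $N-1$, and $P$ and $Q$ have no common factor, and there is a rotation $A\in SO(3)$, such that $\mathbf{v}=A\mathbf{u}$ satisfies $$v_1(x)+\mathrm{i}v_2(x)=\frac{2R(x)}{|R(x)|^2+1},\qquad v_3(x)=\frac{|R(x)|^2-1}{|R(x)|^2+1}$$ for all $x\in\mathbb{R}$ with $Q(x)\neq 0$, and $\mathbf{v}(x)=(0,0,1)$ for all $x\in\mathbb{R}$ with $Q(x)=0$; that is, $\mathbf{v}(x)$ is the image of $R(x)\in\mathbb{C}\cup\{\infty\}$ under the inverse stereographic projection. -/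

import Mathlib

open MeasureTheory Polynomial
open scoped FourierTransform ENNReal

noncomputable section

namespace HalfWave

/-- The Hilbert space `ℂ²`. -/
abbrev C2 : Type := EuclideanSpace ℂ (Fin 2)

/-- Euclidean `ℝ³`. -/
abbrev R3 : Type := EuclideanSpace ℝ (Fin 3)

/-- The unit sphere `S² ⊆ ℝ³`. -/
abbrev S2 : Type := Metric.sphere (0 : R3) 1

/-- The Hilbert space `L²(ℝ; ℂ²)`. -/
abbrev L2 : Type := Lp C2 2 (volume : Measure ℝ)

/-! ### Hardy space, Hankel operator and its square -/

/-- The Hardy space `L²₊(ℝ; ℂ²)`: square integrable functions whose Fourier transform is supported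
in `[0, ∞)`, i.e. vanishes almost everywhere on `(-∞, 0)`. -/
def hardy : Submodule ℂ L2 where
  carrier := {f | ∀ᵐ ξ : ℝ, ξ < 0 → (𝓕 f : L2) ξ = 0}
  zero_mem' := by
    have h : (𝓕 (0 : L2) : L2) = 0 := (Lp.fourierTransformₗᵢ ℝ C2).map_zero
    simp only [Set.mem_ofPred_eq, h]
    filter_upwards [Lp.coeFn_zero C2 2 (volume : Measure ℝ)] with ξ hξ _
    exact hξ
  add_mem' := by
    intro f g hf hg
    have h : (𝓕 (f + g) : L2) = 𝓕 f + 𝓕 g := (Lp.fourierTransformₗᵢ ℝ C2).map_add f g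
    simp only [Set.mem_ofPred_eq, h] at hf hg ⊢
    filter_upwards [hf, hg, Lp.coeFn_add (𝓕 f : L2) (𝓕 g)] with ξ h1 h2 h3 hξ
    rw [h3, Pi.add_apply, h1 hξ, h2 hξ, add_zero]
  smul_mem' := by
    intro c f hf
    have h : (𝓕 (c • f) : L2) = c • 𝓕 f := (Lp.fourierTransformₗᵢ ℝ C2).map_smul c f
    simp only [Set.mem_ofPred_eq, h] at hf ⊢
    filter_upwards [hf, Lp.coeFn_smul c (𝓕 f : L2)] with ξ h1 h3 hξ
    rw [h3, Pi.smul_apply, h1 hξ, smul_zero]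

theorem isClosed_hardy : IsClosed (hardy : Set L2) := by
  have h : (hardy : Set L2) =
      (fun f : L2 => LpToLpRestrictCLM ℝ C2 ℂ volume 2 (Set.Iio 0)
        (Lp.fourierTransformₗᵢ ℝ C2 f)) ⁻¹' {0} := by
    ext f
    have e : (𝓕 f : L2) = Lp.fourierTransformₗᵢ ℝ C2 f := rfl
    simp only [Set.mem_preimage, Set.mem_singleton_iff]
    change (∀ᵐ ξ : ℝ, ξ < 0 → (𝓕 f : L2) ξ = 0) ↔ _
    rw [e, Lp.eq_zero_iff_ae_eq_zero]
    have h1 := LpToLpRestrictCLM_coeFn ℂ (Set.Iio (0 : ℝ)) (Lp.fourierTransformₗᵢ ℝ C2 f)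
    have h3 := ae_restrict_iff' (μ := volume) (s := Set.Iio (0 : ℝ))
      (p := fun ξ => (Lp.fourierTransformₗᵢ ℝ C2 f) ξ = 0) measurableSet_Iio
    simp only [Set.mem_Iio] at h3
    rw [← h3]
    constructor
    · intro h2
      filter_upwards [h1, h2] with ξ a b
      rw [a, b]; rfl
    · intro h2
      filter_upwards [h1, h2] with ξ a b
      rw [← a, b]; rfl
  rw [h]
  exact isClosed_singleton.preimage
    ((LpToLpRestrictCLM ℝ C2 ℂ volume 2 (Set.Iio 0)).continuous.comp
      (Lp.fourierTransformₗᵢ ℝ C2).continuous)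

instance : CompleteSpace hardy := isClosed_hardy.completeSpace_coe

/-- Multiplication `f ↦ F f` on `L²(ℝ; ℂ²)` by a bounded matrix-valued function `F`
(matrices being regarded as operators on `ℂ²`). -/
def mulOp (F : Lp (C2 →L[ℂ] C2) ∞ (volume : Measure ℝ)) : L2 →L[ℂ] L2 :=
  (ContinuousLinearMap.id ℂ (C2 →L[ℂ] C2)).holderL volume ∞ 2 2 F

/-- The Hankel operator `H_F : L²₊ → L²₋ = (L²₊)ᗮ`, `H_F f = Π₋ (F f)`, where `Π₋ = Id - Π₊` is
the orthogonal projection onto the orthogonal complement of the Hardy space. -/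
def hankel (F : Lp (C2 →L[ℂ] C2) ∞ (volume : Measure ℝ)) : hardy →L[ℂ] hardyᗮ :=
  hardyᗮ.orthogonalProjectionOnto ∘L mulOp F ∘L hardy.subtypeL

/-- The operator `K_F = H_F^* H_F` on the Hardy space. -/
def opK (F : Lp (C2 →L[ℂ] C2) ∞ (volume : Measure ℝ)) : hardy →L[ℂ] hardy :=
  ContinuousLinearMap.adjoint (hankel F) ∘L hankel F

/-- The subspace `𝔥₁`: the closure of the range of `K_F` in the Hardy space. -/
def h1 (F : Lp (C2 →L[ℂ] C2) ∞ (volume : Measure ℝ)) : Submodule ℂ hardy :=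
  (LinearMap.range (opK F : hardy →ₗ[ℂ] hardy)).topologicalClosure

/-! ### Rational maps into the sphere -/

/-- `u : ℝ → S²` is rational: each of its components is a quotient of real polynomials, with a
denominator that does not vanish on `ℝ`. -/
def IsRational (u : ℝ → S2) : Prop :=
  ∀ j : Fin 3, ∃ p q : ℝ[X], ∀ x : ℝ, q.eval x ≠ 0 ∧ (u x : R3) j = p.eval x / q.eval x

theorem IsRational.continuous {u : ℝ → S2} (hu : IsRational u) : Continuous u := by
  refine Continuous.subtype_mk (f := fun x => (u x : R3)) ?_ _
  refine (PiLp.continuous_toLp 2 (fun _ : Fin 3 => ℝ)).comp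
    (f := fun x => (u x : R3).ofLp) (continuous_pi fun j => ?_)
  obtain ⟨p, q, h⟩ := hu j
  have e : (fun x => (u x : R3).ofLp j) = fun x => p.eval x / q.eval x := funext fun x => (h x).2
  rw [e]
  exact p.continuous.div q.continuous fun x => (h x).1

/-- The Hermitian matrix `v · σ = v₁ σ₁ + v₂ σ₂ + v₃ σ₃` with the Pauli matrices `σⱼ`. -/
def pauli (v : R3) : Matrix (Fin 2) (Fin 2) ℂ :=
  !![(v 2 : ℂ), (v 0 : ℂ) - Complex.I * (v 1 : ℂ);
     (v 0 : ℂ) + Complex.I * (v 1 : ℂ), -(v 2 : ℂ)]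

theorem continuous_pauli : Continuous pauli := by
  refine continuous_matrix fun i j => ?_
  fin_cases i <;> fin_cases j <;> simp [pauli] <;> fun_prop

theorem continuous_pauliCLM :
    Continuous fun v : S2 => Matrix.toEuclideanCLM (n := Fin 2) (𝕜 := ℂ) (pauli v) := by
  have h : Continuous (Matrix.toEuclideanCLM (n := Fin 2) (𝕜 := ℂ)) :=
    LinearMap.continuous_of_finiteDimensional
      (Matrix.toEuclideanCLM (n := Fin 2) (𝕜 := ℂ)).toAlgEquiv.toLinearMap
  exact h.comp (continuous_pauli.comp continuous_subtype_val)

theorem IsRational.memLp {u : ℝ → S2} (hu : IsRational u) :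
    MemLp (fun x => Matrix.toEuclideanCLM (n := Fin 2) (𝕜 := ℂ) (pauli (u x))) ∞
      (volume : Measure ℝ) := by
  obtain ⟨C, hC⟩ := isCompact_univ.exists_bound_of_continuousOn continuous_pauliCLM.continuousOn
  exact memLp_top_of_bound
    (continuous_pauliCLM.comp hu.continuous).aestronglyMeasurable C
    (Filter.Eventually.of_forall fun x => hC (u x) (Set.mem_univ _))

/-- The bounded matrix-valued symbol `U = u · σ` of a rational map `u : ℝ → S²`. -/
def symbol (u : ℝ → S2) (hu : IsRational u) : Lp (C2 →L[ℂ] C2) ∞ (volume : Measure ℝ) :=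
  hu.memLp.toLp

/-- `D` is a common denominator of `u₁, u₂, u₃`: a nonzero real polynomial such that every `D uⱼ`
is a polynomial. -/
def IsCommonDenominator (u : ℝ → S2) (D : ℝ[X]) : Prop :=
  D ≠ 0 ∧ ∀ j : Fin 3, ∃ p : ℝ[X], ∀ x : ℝ, D.eval x * (u x : R3) j = p.eval x

/-- `D` is a least common denominator of `u₁, u₂, u₃`. -/
def IsLeastCommonDenominator (u : ℝ → S2) (D : ℝ[X]) : Prop :=
  IsCommonDenominator u D ∧ ∀ E : ℝ[X], IsCommonDenominator u E → D ∣ E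

/-! ### Stereographic projection -/

/-- The inverse stereographic projection `ℂ ∪ {∞} → S² ⊆ ℝ³`, with `∞ ↦ e₃`. -/
def invStereo (z : OnePoint ℂ) : R3 :=
  z.elim !₂[0, 0, 1] fun z =>
    !₂[2 * z.re / (Complex.normSq z + 1), 2 * z.im / (Complex.normSq z + 1),
      (Complex.normSq z - 1) / (Complex.normSq z + 1)]

/-- The value in `ℂ ∪ {∞}` of a complex rational function at a real point (`∞` at a pole). -/
def ratValue (R : RatFunc ℂ) (x : ℝ) : OnePoint ℂ :=
  open Classical in
  if R.denom.eval (x : ℂ) = 0 then OnePoint.infty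
  else ((R.eval (RingHom.id ℂ) (x : ℂ) : ℂ) : OnePoint ℂ)

/-- Up to a rotation of the sphere, `u` is the inverse stereographic image of a rational function
`R = P / Q` with `deg P = N`, `Q ≠ 0`, `deg Q ≤ N - 1` and `P, Q` without common factor. -/
def IsStereographicImage (u : ℝ → S2) (N : ℕ) : Prop :=
  ∃ (R : RatFunc ℂ) (P Q : ℂ[X]),
    R = algebraMap ℂ[X] (RatFunc ℂ) P / algebraMap ℂ[X] (RatFunc ℂ) Q ∧
    P.degree = N ∧ Q ≠ 0 ∧ Q.degree < N ∧ IsCoprime P Q ∧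
    ∃ A ∈ Matrix.specialOrthogonalGroup (Fin 3) ℝ, ∀ x : ℝ,
      Matrix.toEuclideanCLM (n := Fin 3) (𝕜 := ℝ) A (u x) = invStereo (ratValue R x)

end HalfWave

end

noncomputable section

namespace HalfWave

/-! ### The inverse Fourier transform on `L¹ ∩ L²` -/

/-! Every rational `u : ℝ → S²` is the inverse stereographic image of a quotient `P / Q` of coprime
complex polynomials, with no degree condition (`exists_isSpinor`). Clearing denominators, `E (u₁ + i
u₂) = 2 P Q̄` and `E u₃ = P P̄ - Q Q̄` with `E = P P̄ + Q Q̄`, where the bar conjugates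
coefficients. Put `M = max (deg P) (deg Q)`. Each of the three statements says that `M = N`.

Denominator. The top coefficients of `P P̄` and `Q Q̄` are nonnegative and cannot cancel, so `deg E
= 2M` (`natDegree_spinDen`). The product of a Bezout identity for `(P, Q)` and its conjugate shows
that `E` divides every common denominator (`IsSpinor.spinDen_dvd`).

Stereographic form. A rotation of the sphere acts on `(P, Q)` through `SU(2)` (`IsSpinor.rot`). A
suitable one sends the vector of coefficients of degree `M` to a multiple of `(1, 0)`, which gives
`deg P = M > deg Q` (`IsSpinor.exists_rot`). Conversely, rotations do not change the common
denominators, so every rotated pair computes the same degree `2M`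
(`exists_isLeastCommonDenominator`).

Rank. The matrix `U + 1 = 2 E⁻¹ (P̄, Q̄)ᵀ (P, Q)` has rank one, and the identity contributes nothing
to the Hankel operator. As `E` is real without real zeros, `E = E₊ E₋` with `M` zeros in each
half-plane. For rational `f` in the Hardy space, partial fractions of `(P f₁ + Q f₂) / E` leave a
term `α / E₊`, and `H_U f` is twice the polar part of `(P̄ α, Q̄ α) / E₊` (`coProjMul_ratVec`).
These polar parts form a space isomorphic to `ℂ[X] / (E₊)`, by coprimality of `P̄` and `Q̄`, hence
of dimension `M`. All of them occur, and density of the Cauchy kernels in the Hardy space excludes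
anything else (`map_range_hankel`). Finally `H_U` and `H_U^* H_U` have the same kernel, hence the
same rank. -/

theorem fourierInv_toLp {h g : ℝ → C2} (h1 : Integrable h) (h2 : MemLp h 2 volume)
    (hg : MemLp g 2 volume) (hgh : ∀ x, 𝓕⁻ h x = g x) :
    (𝓕⁻ (h2.toLp h) : L2) = hg.toLp g := by
  -- The abstract `L²` transform and the integral are compared as tempered distributions, into which
  -- `L²` embeds. There the claim becomes the self-adjointness of the inverse Fourier integral,
  -- tested against Schwartz functions.
  have hinj : Function.Injective (Lp.toTemperedDistributionCLM (E := ℝ) C2 volume 2) :=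
    LinearMap.ker_eq_bot.1 Lp.ker_toTemperedDistributionCLM_eq_bot
  apply hinj
  rw [Lp.toTemperedDistributionCLM_apply, Lp.toTemperedDistributionCLM_apply,
    ← Lp.fourierInv_toTemperedDistribution_eq]
  ext φ : 1
  rw [TemperedDistribution.fourierInv_apply, Lp.toTemperedDistribution_apply,
    Lp.toTemperedDistribution_apply]
  have e1 : ∫ x, (𝓕⁻ φ) x • (h2.toLp h) x = ∫ x, (𝓕⁻ (φ : ℝ → ℂ)) x • h x := by
    apply integral_congr_ae
    filter_upwards [h2.coeFn_toLp] with x hx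
    rw [hx, SchwartzMap.fourierInv_coe]
  have e2 : ∫ x, φ x • (hg.toLp g) x = ∫ x, φ x • (𝓕⁻ h) x := by
    apply integral_congr_ae
    filter_upwards [hg.coeFn_toLp] with x hx
    rw [hx, hgh]
  rw [e1, e2]
  have := VectorFourier.integral_fourierIntegral_smul_eq_flip (μ := volume) (ν := volume)
    (L := -innerₗ ℝ) (e := Real.fourierChar) (f := φ) (g := h)
    Real.continuous_fourierChar 
    (by simp only [LinearMap.neg_apply, innerₗ_apply_apply]; fun_prop) φ.integrable h1
  have hf : (-innerₗ ℝ).flip = -innerₗ ℝ := by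
    ext; simp
  rw [hf] at this
  exact this

/-! ### Cauchy kernels -/

/-- The `ℂ²`-valued Cauchy kernel `x ↦ v / (x - w)`. -/
def cauchy (w : ℂ) (v : C2) : ℝ → C2 := fun x => ((x : ℂ) - w)⁻¹ • v

theorem ofReal_sub_ne_zero {w : ℂ} (hw : w.im ≠ 0) (x : ℝ) : (x : ℂ) - w ≠ 0 := by
  intro h
  apply hw
  have := congrArg Complex.im h
  simpa using this

theorem continuous_resolvent {w : ℂ} (hw : w.im ≠ 0) :
    Continuous fun x : ℝ => ((x : ℂ) - w)⁻¹ :=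
  Continuous.inv₀ (by fun_prop) (ofReal_sub_ne_zero hw)

theorem norm_resolvent_le {w : ℂ} (hw : w.im ≠ 0) (x : ℝ) : ‖((x : ℂ) - w)⁻¹‖ ≤ |w.im|⁻¹ := by
  rw [norm_inv]
  have := Complex.abs_im_le_norm ((x : ℂ) - w)
  simp only [Complex.sub_im, Complex.ofReal_im, zero_sub, abs_neg] at this
  exact inv_anti₀ (abs_pos.2 hw) this

theorem memLp_resolvent {w : ℂ} (hw : w.im ≠ 0) :
    MemLp (fun x : ℝ => ((x : ℂ) - w)⁻¹) 2 volume := by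
  rw [memLp_two_iff_integrable_sq_norm (continuous_resolvent hw).aestronglyMeasurable]
  have h1 : Integrable fun x : ℝ => w.im ^ (-2 : ℤ) * (1 + (w.im⁻¹ * (x + -w.re)) ^ 2)⁻¹ :=
    ((integrable_inv_one_add_sq.comp_mul_left' (inv_ne_zero hw)).comp_add_right (-w.re)).const_mul _
  refine h1.congr (Filter.Eventually.of_forall fun x => ?_)
  simp only
  symm
  rw [norm_inv, inv_pow, Complex.sq_norm, Complex.normSq_apply]
  simp only [Complex.sub_re, Complex.ofReal_re, Complex.sub_im, Complex.ofReal_im]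
  rw [zpow_neg, ← mul_inv]
  congr 1
  rw [mul_add, mul_pow, inv_pow]
  norm_cast
  field_simp
  ring

theorem memLp_cauchy {w : ℂ} (hw : w.im ≠ 0) (v : C2) : MemLp (cauchy w v) 2 volume :=
  ((ContinuousLinearMap.id ℂ ℂ).smulRight v).comp_memLp' (memLp_resolvent hw)

/-- The one-sided exponential `ξ ↦ 1_{ξ > 0} e^{-2πiwξ} v`. -/
def expPos (w : ℂ) (v : C2) : ℝ → C2 :=
  (Set.Ioi 0).indicator fun ξ : ℝ => Complex.exp (-(2 * Real.pi * Complex.I * w) * ξ) • v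

/-- The one-sided exponential `ξ ↦ 1_{ξ < 0} e^{-2πiwξ} v`. -/
def expNeg (w : ℂ) (v : C2) : ℝ → C2 :=
  (Set.Iio 0).indicator fun ξ : ℝ => Complex.exp (-(2 * Real.pi * Complex.I * w) * ξ) • v

theorem re_exponent (w : ℂ) : (-(2 * Real.pi * Complex.I * w)).re = 2 * Real.pi * w.im := by
  simp

theorem integrable_expPos {w : ℂ} (hw : w.im < 0) (v : C2) : Integrable (expPos w v) := by
  rw [expPos, integrable_indicator_iff measurableSet_Ioi]
  exact Integrable.smul_const (integrableOn_exp_mul_complex_Ioi (by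
    rw [re_exponent]; exact mul_neg_of_pos_of_neg (by positivity) hw) 0) v

theorem integrable_expNeg {w : ℂ} (hw : 0 < w.im) (v : C2) : Integrable (expNeg w v) := by
  rw [expNeg, integrable_indicator_iff measurableSet_Iio]
  exact Integrable.smul_const ((integrableOn_exp_mul_complex_Iic (by
    rw [re_exponent]; positivity) 0).mono_set Set.Iio_subset_Iic_self) v

theorem norm_exp_le_one {w : ℂ} {ξ : ℝ} (h : w.im * ξ ≤ 0) :
    ‖Complex.exp (-(2 * Real.pi * Complex.I * w) * ξ)‖ ≤ 1 := by
  rw [Complex.norm_exp, Complex.re_mul_ofReal, re_exponent, Real.exp_le_one_iff, mul_assoc]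
  exact mul_nonpos_of_nonneg_of_nonpos (by positivity) h

theorem memLp_two_of_integrable_of_bound {F : Type*} [NormedAddCommGroup F] {h : ℝ → F}
    (hi : Integrable h) {C : ℝ} (hC : ∀ x, ‖h x‖ ≤ C) : MemLp h 2 volume := by
  rw [memLp_two_iff_integrable_sq_norm hi.1]
  simp_rw [sq]
  refine hi.norm.bdd_mul (c := C) hi.norm.1 (Filter.Eventually.of_forall fun x => ?_)
  simpa using hC x

theorem memLp_expPos {w : ℂ} (hw : w.im < 0) (v : C2) : MemLp (expPos w v) 2 volume := by
  refine memLp_two_of_integrable_of_bound (integrable_expPos hw v) (C := ‖v‖) fun x => ?_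
  unfold expPos Set.indicator
  split_ifs with h
  · rw [norm_smul]
    exact mul_le_of_le_one_left (norm_nonneg _)
      (norm_exp_le_one (mul_nonpos_of_nonpos_of_nonneg hw.le (le_of_lt h)))
  · simp

theorem memLp_expNeg {w : ℂ} (hw : 0 < w.im) (v : C2) : MemLp (expNeg w v) 2 volume := by
  refine memLp_two_of_integrable_of_bound (integrable_expNeg hw v) (C := ‖v‖) fun x => ?_
  unfold expNeg Set.indicator
  split_ifs with h
  · rw [norm_smul]
    exact mul_le_of_le_one_left (norm_nonneg _)
      (norm_exp_le_one (mul_nonpos_of_nonneg_of_nonpos hw.le (le_of_lt h)))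
  · simp

theorem fourierInv_indicator_exp {s : Set ℝ} (hs : MeasurableSet s) (w : ℂ) (v : C2) (x : ℝ) :
    𝓕⁻ (s.indicator fun ξ : ℝ => Complex.exp (-(2 * Real.pi * Complex.I * w) * ξ) • v) x =
      (∫ ξ in s, Complex.exp (2 * Real.pi * Complex.I * (x - w) * ξ)) • v := by
  rw [Real.fourierInv_eq', ← integral_smul_const, ← integral_indicator hs]
  congr 1
  ext1 ξ
  by_cases h : ξ ∈ s
  · simp only [Set.indicator_of_mem h, smul_smul, ← Complex.exp_add]
    congr 2
    simp
    ring
  · simp [Set.indicator_of_notMem h]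

/-- For `Im w < 0` the integral of `e^{2πi(x-w)ξ}` over `ξ > 0` converges to `-(2πi(x-w))⁻¹`, which
accounts for the constant. -/
theorem fourierInv_expPos {w : ℂ} (hw : w.im < 0) (v : C2) (x : ℝ) :
    𝓕⁻ (expPos w v) x = cauchy w ((-(2 * Real.pi * Complex.I))⁻¹ • v) x := by
  rw [expPos, fourierInv_indicator_exp measurableSet_Ioi, integral_exp_mul_complex_Ioi, cauchy,
    smul_smul]
  · congr 1
    simp [neg_div]
  · simp
    exact mul_neg_of_pos_of_neg (by positivity) hw

theorem fourierInv_expNeg {w : ℂ} (hw : 0 < w.im) (v : C2) (x : ℝ) :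
    𝓕⁻ (expNeg w v) x = cauchy w ((2 * Real.pi * Complex.I)⁻¹ • v) x := by
  rw [expNeg, fourierInv_indicator_exp measurableSet_Iio, ← integral_Iic_eq_integral_Iio,
    integral_exp_mul_complex_Iic, cauchy, smul_smul]
  · congr 1
    simp
  · simp
    positivity

/-! ### Cauchy kernels in the Hardy space and in its orthogonal complement -/

/-- The function `f` is square integrable and its class belongs to the subspace `S`. -/
def Represents (S : Submodule ℂ L2) (f : ℝ → C2) : Prop :=
  ∃ h : MemLp f 2 volume, h.toLp f ∈ S

theorem Represents.add {S : Submodule ℂ L2} {f g : ℝ → C2} (hf : Represents S f)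
    (hg : Represents S g) : Represents S fun x => f x + g x :=
  ⟨hf.1.add hg.1, by
    have := S.add_mem hf.2 hg.2
    rwa [← MemLp.toLp_add] at this⟩

theorem Represents.smul {S : Submodule ℂ L2} {f : ℝ → C2} (hf : Represents S f) (c : ℂ) :
    Represents S fun x => c • f x :=
  ⟨hf.1.const_smul c, by
    have := S.smul_mem c hf.2
    rwa [← MemLp.toLp_const_smul] at this⟩

theorem Represents.zero (S : Submodule ℂ L2) : Represents S fun _ => 0 :=
  ⟨MemLp.zero, by
    have : MemLp.toLp (fun _ : ℝ => (0 : C2)) (MemLp.zero (p := 2) (μ := volume)) = 0 :=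
      MemLp.toLp_zero _
    rw [this]; exact S.zero_mem⟩

theorem Represents.congr {S : Submodule ℂ L2} {f g : ℝ → C2} (hf : Represents S f)
    (h : ∀ x, f x = g x) : Represents S g := by
  have : f = g := funext h
  rwa [← this]

theorem mem_hardy_iff (f : L2) : f ∈ hardy ↔ ∀ᵐ ξ : ℝ, ξ < 0 → (𝓕 f : L2) ξ = 0 := Iff.rfl

theorem fourier_cauchy_of_neg {w : ℂ} (hw : w.im < 0) (v : C2) :
    (𝓕 ((memLp_cauchy hw.ne v).toLp (cauchy w v)) : L2) =
      (memLp_expPos hw (-(2 * Real.pi * Complex.I) • v)).toLp _ := by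
  rw [← fourierInv_toLp (integrable_expPos hw (-(2 * Real.pi * Complex.I) • v))
    (memLp_expPos hw (-(2 * Real.pi * Complex.I) • v)) (memLp_cauchy hw.ne v) fun x => ?_]
  · exact FourierTransform.fourier_fourierInv_eq _
  · rw [fourierInv_expPos hw, smul_smul, inv_mul_cancel₀, one_smul]
    simp [Real.pi_ne_zero]

theorem fourier_cauchy_of_pos {w : ℂ} (hw : 0 < w.im) (v : C2) :
    (𝓕 ((memLp_cauchy hw.ne' v).toLp (cauchy w v)) : L2) =
      (memLp_expNeg hw ((2 * Real.pi * Complex.I) • v)).toLp _ := by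
  rw [← fourierInv_toLp (integrable_expNeg hw ((2 * Real.pi * Complex.I) • v))
    (memLp_expNeg hw ((2 * Real.pi * Complex.I) • v)) (memLp_cauchy hw.ne' v) fun x => ?_]
  · exact FourierTransform.fourier_fourierInv_eq _
  · rw [fourierInv_expNeg hw, smul_smul, inv_mul_cancel₀, one_smul]
    simp [Real.pi_ne_zero]

theorem cauchy_mem_hardy {w : ℂ} (hw : w.im < 0) (v : C2) :
    (memLp_cauchy hw.ne v).toLp (cauchy w v) ∈ hardy := by
  rw [mem_hardy_iff, fourier_cauchy_of_neg hw]
  filter_upwards [(memLp_expPos hw (-(2 * Real.pi * Complex.I) • v)).coeFn_toLp] with ξ hξ h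
  rw [hξ, expPos, Set.indicator_of_notMem]
  simpa using h.le

/-- By Plancherel: the transform of the kernel lives on `ξ < 0`, where that of a Hardy function
vanishes. -/
theorem cauchy_mem_hardy_orthogonal {w : ℂ} (hw : 0 < w.im) (v : C2) :
    (memLp_cauchy hw.ne' v).toLp (cauchy w v) ∈ hardyᗮ := by
  rw [Submodule.mem_orthogonal]
  intro f hf
  rw [← Lp.inner_fourier_eq, fourier_cauchy_of_pos hw, L2.inner_def]
  apply integral_eq_zero_of_ae
  filter_upwards [(memLp_expNeg hw ((2 * Real.pi * Complex.I) • v)).coeFn_toLp,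
    (mem_hardy_iff f).1 hf] with ξ hξ h
  rw [hξ]
  by_cases h0 : ξ < 0
  · rw [h h0, inner_zero_left]; rfl
  · rw [expNeg, Set.indicator_of_notMem (by simpa using h0), inner_zero_right]; rfl

/-- The Cauchy kernels with pole on the horizontal line of height `-a`. -/
def cauchyLine (a : ℝ) : Set L2 :=
  {f | ∃ (w : ℂ) (v : C2), w.im = -a ∧ (f : ℝ → C2) =ᵐ[volume] cauchy w v}

/-- The function `ξ ↦ 1_{ξ > 0} e^{-2πaξ} f(ξ)`. -/
def damped (a : ℝ) (f : ℝ → C2) : ℝ → C2 :=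
  (Set.Ioi 0).indicator fun ξ : ℝ =>
    Complex.exp (-(2 * Real.pi * Complex.I * (-a * Complex.I : ℂ)) * ξ) • f ξ

theorem im_neg_mul_I (a : ℝ) : (-a * Complex.I : ℂ).im = -a := by simp

theorem memLp_damped {a : ℝ} (ha : 0 < a) (f : L2) : MemLp (damped a f) 2 volume := by
  have hm : AEStronglyMeasurable (damped a f) volume := by
    have hc : Continuous fun ξ : ℝ =>
        Complex.exp (-(2 * Real.pi * Complex.I * (-a * Complex.I : ℂ)) * ξ) := by fun_prop
    exact (hc.aestronglyMeasurable.smul (Lp.aestronglyMeasurable f)).indicator measurableSet_Ioi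
  refine (Lp.memLp f).of_le hm (Filter.Eventually.of_forall fun ξ => ?_)
  simp only [damped, Set.indicator]
  split_ifs with h
  · rw [norm_smul]
    refine mul_le_of_le_one_left (norm_nonneg _) (norm_exp_le_one ?_)
    rw [im_neg_mul_I]
    exact mul_nonpos_of_nonpos_of_nonneg (by linarith) (le_of_lt h)
  · simp

theorem integrable_damped {a : ℝ} (ha : 0 < a) (f : L2) : Integrable (damped a f) := by
  have h1 : MemLp ((Set.Ioi 0).indicator fun ξ : ℝ =>
      Complex.exp (-(2 * Real.pi * Complex.I * (-a * Complex.I : ℂ)) * ξ)) 2 volume := by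
    refine memLp_two_of_integrable_of_bound (C := 1) ?_ fun ξ => ?_
    · rw [integrable_indicator_iff measurableSet_Ioi]
      refine integrableOn_exp_mul_complex_Ioi ?_ 0
      rw [re_exponent, im_neg_mul_I]
      exact mul_neg_of_pos_of_neg (by positivity) (by linarith)
    · unfold Set.indicator
      split_ifs with h
      · refine norm_exp_le_one ?_
        rw [im_neg_mul_I]
        exact mul_nonpos_of_nonpos_of_nonneg (by linarith) (le_of_lt h)
      · simp
  have := (Lp.memLp f).smul (r := 1) h1
  rw [memLp_one_iff_integrable] at this
  refine this.congr (Filter.Eventually.of_forall fun ξ => ?_)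
  simp only [damped, Set.indicator, Pi.smul_apply']
  split_ifs <;> simp

theorem inner_expPos_eq (a τ ξ : ℝ) (v y : C2) (f : ℝ → C2) (hy : f ξ = y) :
    inner ℂ (expPos (τ - a * Complex.I) v ξ) y =
      inner ℂ v (Complex.exp (((2 * Real.pi * inner ℝ ξ τ : ℝ) : ℂ) * Complex.I) •
        damped a f ξ) := by
  by_cases hp : ξ ∈ Set.Ioi (0 : ℝ)
  · simp only [damped, expPos, Set.indicator_of_mem hp, inner_smul_left, inner_smul_right, hy]
    rw [← Complex.exp_conj]
    have : (starRingEnd ℂ) (-(2 * Real.pi * Complex.I * (τ - a * Complex.I)) * ξ) =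
        ((2 * Real.pi * inner ℝ ξ τ : ℝ) : ℂ) * Complex.I +
          -(2 * Real.pi * Complex.I * (-a * Complex.I : ℂ)) * ξ := by
      simp [Complex.conj_ofNat]
      ring_nf
    rw [this, Complex.exp_add, mul_assoc]
  · simp [damped, expPos, Set.indicator_of_notMem hp]

/-- By Plancherel, pairing with the kernel at `τ - ia` is, up to a constant, evaluation of the
inverse transform of `1_{ξ>0} e^{-2πaξ} 𝓕 f` at `τ`. For `f` in the Hardy space this is the value at
`τ + ia` of the holomorphic extension. -/
theorem fourierInv_damped_eq_zero {a : ℝ} (ha : 0 < a) {f : L2}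
    (h : ∀ g ∈ cauchyLine a, inner ℂ g f = 0) (τ : ℝ) :
    𝓕⁻ (damped a (𝓕 f : L2)) τ = 0 := by
  refine ext_inner_left ℂ fun v => ?_
  rw [inner_zero_right]
  have hw : (τ - a * Complex.I : ℂ).im < 0 := by simpa using ha
  have hne : (-(2 * Real.pi * Complex.I) : ℂ) ≠ 0 := by simp [Real.pi_ne_zero]
  -- The test vector is rescaled to absorb the factor `-2πi` in the transform of the Cauchy kernel.
  obtain ⟨v, rfl⟩ : ∃ v', v = -(2 * Real.pi * Complex.I : ℂ) • v' :=
    ⟨(-(2 * Real.pi * Complex.I : ℂ))⁻¹ • v, by rw [smul_smul, mul_inv_cancel₀ hne, one_smul]⟩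
  have h0 := h _ (show (memLp_cauchy hw.ne v).toLp (cauchy _ v) ∈ cauchyLine a from
    ⟨_, v, by simp, (memLp_cauchy hw.ne v).coeFn_toLp⟩)
  rw [← Lp.inner_fourier_eq, fourier_cauchy_of_neg hw, L2.inner_def] at h0
  have hint : Integrable fun ξ : ℝ => Complex.exp (((2 * Real.pi * inner ℝ ξ τ : ℝ) : ℂ) *
      Complex.I) • damped a (𝓕 f : L2) ξ := by
    have hc : Continuous fun ξ : ℝ => Complex.exp (((2 * Real.pi * inner ℝ ξ τ : ℝ) : ℂ) *
      Complex.I) := by fun_prop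
    refine (integrable_damped ha (𝓕 f : L2)).mono
      (hc.aestronglyMeasurable.smul (integrable_damped ha (𝓕 f : L2)).1)
      (Filter.Eventually.of_forall fun ξ => ?_)
    rw [norm_smul, Complex.norm_exp_ofReal_mul_I, one_mul]
  rw [Real.fourierInv_eq', ← integral_inner hint, ← h0]
  apply integral_congr_ae
  filter_upwards [(memLp_expPos hw (-(2 * Real.pi * Complex.I) • v)).coeFn_toLp] with ξ hξ
  rw [hξ, inner_expPos_eq a τ ξ _ _ (𝓕 f : L2) rfl]

/-- Damping makes the transform integrable, so its vanishing inverse transform forces it to be zero.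
The exponential never vanishes, hence `𝓕 f = 0` on `ξ > 0`, while membership in the Hardy space
covers `ξ < 0`. -/
theorem eq_zero_of_mem_hardy_of_inner_cauchyLine {a : ℝ} (ha : 0 < a) {f : L2} (hf : f ∈ hardy)
    (h : ∀ g ∈ cauchyLine a, inner ℂ g f = 0) : f = 0 := by
  have hF2 := memLp_damped ha (𝓕 f : L2)
  have hF0 : hF2.toLp _ = 0 := by
    have h1 := fourierInv_toLp (integrable_damped ha (𝓕 f : L2)) hF2 (g := fun _ => 0) MemLp.zero
      (fourierInv_damped_eq_zero ha h)
    have h2 : MemLp.toLp (fun _ : ℝ => (0 : C2)) (MemLp.zero (p := 2) (μ := volume)) = 0 :=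
      MemLp.toLp_zero _
    rw [h2] at h1
    exact (Lp.fourierTransformₗᵢ ℝ C2).symm.map_eq_zero_iff.1 h1
  have hf0 : (𝓕 f : L2) = 0 := by
    rw [Lp.eq_zero_iff_ae_eq_zero]
    have h1 := hF2.coeFn_toLp
    rw [hF0] at h1
    filter_upwards [h1, Lp.coeFn_zero C2 2 (volume : Measure ℝ), (mem_hardy_iff f).1 hf,
      compl_mem_ae_iff.2 (measure_singleton (μ := volume) (0 : ℝ))] with ξ h1 h2 h3 h4
    rcases lt_trichotomy ξ 0 with hξ | hξ | hξ
    · exact h3 hξ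
    · exact absurd hξ h4
    · rw [h2] at h1
      simp only [damped, Set.indicator_of_mem (Set.mem_Ioi.2 hξ)] at h1
      exact (smul_eq_zero.1 h1.symm).resolve_left (Complex.exp_ne_zero _)
  exact (Lp.fourierTransformₗᵢ ℝ C2).map_eq_zero_iff.1 hf0

theorem cauchyLine_subset_hardy {a : ℝ} (ha : 0 < a) : cauchyLine a ⊆ hardy := by
  rintro f ⟨w, v, hw, hf⟩
  have hw' : w.im < 0 := by rw [hw]; simpa using ha
  have : f = (memLp_cauchy hw'.ne v).toLp (cauchy w v) := by
    apply Lp.ext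
    filter_upwards [hf, (memLp_cauchy hw'.ne v).coeFn_toLp] with x h1 h2
    rw [h1, h2]
  rw [this]
  exact cauchy_mem_hardy hw' v

/-- Poles on a single line suffice, and the line is free. This freedom is what keeps the poles of
the test kernels away from a prescribed point. -/
theorem hardy_le_closure_span {a : ℝ} (ha : 0 < a) :
    hardy ≤ (Submodule.span ℂ (cauchyLine a)).topologicalClosure := by
  set S := (Submodule.span ℂ (cauchyLine a)).topologicalClosure
  have hS : S ≤ hardy :=
    Submodule.topologicalClosure_minimal _ (Submodule.span_le.2 (cauchyLine_subset_hardy ha))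
      isClosed_hardy
  have : CompleteSpace S := (Submodule.isClosed_topologicalClosure _).completeSpace_coe
  intro f hf
  have h1 : f - S.starProjection f ∈ Sᗮ := Submodule.sub_starProjection_mem_orthogonal f
  have h2 : f - S.starProjection f = 0 := by
    refine eq_zero_of_mem_hardy_of_inner_cauchyLine ha
      (hardy.sub_mem hf (hS (Submodule.starProjection_apply_mem _ _))) fun g hg => ?_
    exact (Submodule.mem_orthogonal _ _).1 h1 g
      (Submodule.le_topologicalClosure _ (Submodule.subset_span hg))
  rw [sub_eq_zero.1 h2]
  exact Submodule.starProjection_apply_mem _ _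

/-! ### Multiplication operators and rational functions -/

theorem mulOp_coeFn (F : Lp (C2 →L[ℂ] C2) ∞ (volume : Measure ℝ)) (f : L2) :
    (mulOp F f : ℝ → C2) =ᵐ[volume] fun x => F x (f x) :=
  ContinuousLinearMap.coeFn_holder (ContinuousLinearMap.id ℂ (C2 →L[ℂ] C2)) F f

theorem mulOp_toLp_coeFn {F : ℝ → C2 →L[ℂ] C2} (hF : MemLp F ∞ volume) (f : L2) :
    (mulOp (hF.toLp F) f : ℝ → C2) =ᵐ[volume] fun x => F x (f x) := by
  filter_upwards [mulOp_coeFn (hF.toLp F) f, hF.coeFn_toLp] with x h1 h2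
  rw [h1, h2]

theorem memLp_resolventCLM {w : ℂ} (hw : w.im ≠ 0) :
    MemLp (fun x : ℝ => ((x : ℂ) - w)⁻¹ • (1 : C2 →L[ℂ] C2)) ∞ volume := by
  refine memLp_top_of_bound ((continuous_resolvent hw).smul continuous_const).aestronglyMeasurable
    (|w.im|⁻¹ * ‖(1 : C2 →L[ℂ] C2)‖) (Filter.Eventually.of_forall fun x => ?_)
  rw [norm_smul]
  exact mul_le_mul_of_nonneg_right (norm_resolvent_le hw x) (norm_nonneg _)

/-- Multiplication by `x ↦ (x - w)⁻¹` on `L²(ℝ; ℂ²)`. -/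
def resolventOp {w : ℂ} (hw : w.im ≠ 0) : L2 →L[ℂ] L2 :=
  mulOp ((memLp_resolventCLM hw).toLp _)

theorem resolventOp_coeFn {w : ℂ} (hw : w.im ≠ 0) (f : L2) :
    (resolventOp hw f : ℝ → C2) =ᵐ[volume] fun x => ((x : ℂ) - w)⁻¹ • f x := by
  filter_upwards [mulOp_toLp_coeFn (memLp_resolventCLM hw) f] with x hx
  rw [resolventOp, hx]
  simp

/-- By density it is enough to multiply Cauchy kernels, and a product of two simple poles at
distinct points splits by partial fractions. -/
theorem resolventOp_mem_hardy {w : ℂ} (hw : w.im < 0) {f : L2} (hf : f ∈ hardy) :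
    resolventOp hw.ne f ∈ hardy := by
  -- The poles of the test kernels are placed one unit below `w`, so that they never coincide with
  -- it.
  have ha : 0 < 1 - w.im := by linarith
  suffices h : hardy ≤ hardy.comap (resolventOp hw.ne : L2 →ₗ[ℂ] L2) from h hf
  refine (hardy_le_closure_span ha).trans (Submodule.topologicalClosure_minimal _
    (Submodule.span_le.2 ?_) (isClosed_hardy.preimage (resolventOp hw.ne).continuous))
  rintro g ⟨w', v, hw', hg⟩
  have hne : w - w' ≠ 0 := by
    intro h
    have := congrArg Complex.im h
    rw [Complex.sub_im, Complex.zero_im, hw'] at this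
    linarith
  have hw'' : w'.im < 0 := by linarith
  have key : resolventOp hw.ne g = (memLp_cauchy hw.ne ((w - w')⁻¹ • v)).toLp _ -
      (memLp_cauchy hw''.ne ((w - w')⁻¹ • v)).toLp _ := by
    rw [← MemLp.toLp_sub]
    apply Lp.ext
    filter_upwards [resolventOp_coeFn hw.ne g, hg, ((memLp_cauchy hw.ne ((w - w')⁻¹ • v)).sub
      (memLp_cauchy hw''.ne ((w - w')⁻¹ • v))).coeFn_toLp] with x h1 h2 h3
    rw [h1, h2, h3, Pi.sub_apply]
    simp only [cauchy, smul_smul, ← sub_smul]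
    congr 1
    have e1 := ofReal_sub_ne_zero hw.ne x
    have e2 := ofReal_sub_ne_zero hw''.ne x
    field_simp
    ring
  change resolventOp hw.ne g ∈ hardy
  rw [key]
  exact hardy.sub_mem (cauchy_mem_hardy hw _) (cauchy_mem_hardy hw'' _)

/-- The adjoint of multiplication by `(x - w)⁻¹` is multiplication by `(x - w̄)⁻¹`, which preserves
the Hardy space. -/
theorem resolventOp_mem_hardy_orthogonal {w : ℂ} (hw : 0 < w.im) {f : L2} (hf : f ∈ hardyᗮ) :
    resolventOp hw.ne' f ∈ hardyᗮ := by
  have hw' : ((starRingEnd ℂ) w).im < 0 := by simpa using hw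
  rw [Submodule.mem_orthogonal] at hf ⊢
  intro g hg
  rw [← hf _ (resolventOp_mem_hardy hw' hg), L2.inner_def, L2.inner_def]
  apply integral_congr_ae
  filter_upwards [resolventOp_coeFn hw.ne' f, resolventOp_coeFn hw'.ne g] with x h1 h2
  rw [h1, h2, inner_smul_left, inner_smul_right]
  simp

/-- The subspace `S` contains the Cauchy kernels with pole `r` and is stable under multiplication
by `x ↦ (x - r)⁻¹`. -/
def CauchyStable (S : Submodule ℂ L2) (r : ℂ) : Prop :=
  (∀ v, Represents S (cauchy r v)) ∧
    ∀ f, Represents S f → Represents S fun x => ((x : ℂ) - r)⁻¹ • f x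

theorem Represents.of_resolventOp {S : Submodule ℂ L2} {w : ℂ} (hw : w.im ≠ 0)
    (h : ∀ f ∈ S, resolventOp hw f ∈ S) {f : ℝ → C2} (hf : Represents S f) :
    Represents S fun x => ((x : ℂ) - w)⁻¹ • f x := by
  obtain ⟨h1, h2⟩ := hf
  have h3 : (resolventOp hw (h1.toLp f) : ℝ → C2) =ᵐ[volume] fun x => ((x : ℂ) - w)⁻¹ • f x := by
    filter_upwards [resolventOp_coeFn hw (h1.toLp f), h1.coeFn_toLp] with x e1 e2
    rw [e1, e2]
  have h4 : MemLp (fun x : ℝ => ((x : ℂ) - w)⁻¹ • f x) 2 volume :=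
    (memLp_congr_ae h3).1 (Lp.memLp _)
  refine ⟨h4, ?_⟩
  have h5 : h4.toLp _ = resolventOp hw (h1.toLp f) := by
    apply Lp.ext
    filter_upwards [h4.coeFn_toLp, h3] with x e1 e2
    rw [e1, e2]
  rw [h5]
  exact h _ h2

theorem cauchyStable_hardy {r : ℂ} (hr : r.im < 0) : CauchyStable hardy r :=
  ⟨fun v => ⟨_, cauchy_mem_hardy hr v⟩,
    fun _ hf => hf.of_resolventOp hr.ne fun _ => resolventOp_mem_hardy hr⟩

theorem cauchyStable_hardy_orthogonal {r : ℂ} (hr : 0 < r.im) : CauchyStable hardyᗮ r :=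
  ⟨fun v => ⟨_, cauchy_mem_hardy_orthogonal hr v⟩,
    fun _ hf => hf.of_resolventOp hr.ne' fun _ => resolventOp_mem_hardy_orthogonal hr⟩

/-- Induction on the poles: with `q` the product over `s`, the quotient of `p` by `q` is a constant
`c` for degree reasons, and `p / ((x - r) q) = c / (x - r) + (x - r)⁻¹ (p mod q) / q`. Repeated
poles need no separate treatment. -/
theorem CauchyStable.represents_prod {S : Submodule ℂ L2} (s : Multiset ℂ)
    (hs : ∀ r ∈ s, CauchyStable S r) (hs' : ∀ r ∈ s, r.im ≠ 0) (p : ℂ[X])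
    (hp : p.degree < s.card) (v : C2) :
    Represents S fun x => (p.eval (x : ℂ) / (s.map fun r => X - C r).prod.eval (x : ℂ)) • v := by
  induction s using Multiset.induction_on generalizing p with
  | empty =>
    have : p = 0 := by
      rw [← degree_eq_bot]
      simpa using hp
    simpa [this] using Represents.zero S
  | cons r s ih =>
    set q := (s.map fun r => X - C r).prod with hq
    have hqm : q.Monic := monic_multiset_prod_of_monic _ _ fun r _ => monic_X_sub_C r
    have hqd : q.degree = s.card := by
      rw [degree_eq_natDegree hqm.ne_zero, hq, natDegree_multiset_prod_X_sub_C_eq_card]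
    have hdiv : (p /ₘ q).degree ≤ 0 := by
      by_cases h : p.degree < q.degree
      · rw [(divByMonic_eq_zero_iff hqm).2 h]; simp
      · rw [Multiset.card_cons] at hp
        have h1 := degree_add_divByMonic hqm (not_lt.1 h)
        by_cases h0 : p /ₘ q = 0
        · simp [h0]
        have hp0 : p ≠ 0 := by rintro rfl; simp at h0
        rw [hqd, degree_eq_natDegree h0, degree_eq_natDegree hp0] at h1
        rw [degree_eq_natDegree hp0] at hp
        rw [degree_eq_natDegree h0]
        norm_cast at h1 hp ⊢
        omega
    obtain ⟨c, hc⟩ : ∃ c, p /ₘ q = C c := ⟨_, eq_C_of_degree_le_zero hdiv⟩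
    have ih' := ih (fun r' hr' => hs r' (Multiset.mem_cons_of_mem hr'))
      (fun r' hr' => hs' r' (Multiset.mem_cons_of_mem hr')) (p %ₘ q)
      (by rw [← hqd]; exact degree_modByMonic_lt _ hqm)
    have hr := hs r (Multiset.mem_cons_self r s)
    refine ((hr.1 (c • v)).add (hr.2 _ ih')).congr fun x => ?_
    have hx := ofReal_sub_ne_zero (hs' r (Multiset.mem_cons_self r s)) x
    have hqx : q.eval (x : ℂ) ≠ 0 := by
      rw [hq, eval_multiset_prod, Multiset.map_map]
      simp only [Function.comp, eval_sub, eval_X, eval_C]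
      rw [Ne, Multiset.prod_eq_zero_iff, Multiset.mem_map]
      rintro ⟨r', hr', h0⟩
      exact ofReal_sub_ne_zero (hs' r' (Multiset.mem_cons_of_mem hr')) x h0
    have hpx : p.eval (x : ℂ) = (p %ₘ q).eval (x : ℂ) + q.eval (x : ℂ) * c := by
      conv_lhs => rw [← modByMonic_add_div p q, hc]
      simp
    simp only [cauchy, smul_smul, ← add_smul, Multiset.map_cons, Multiset.prod_cons, eval_mul,
      eval_sub, eval_X, eval_C, hpx]
    congr 1
    rw [← hq]
    field_simp
    ring

theorem CauchyStable.represents_div {S : Submodule ℂ L2} {p q : ℂ[X]}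
    (hs : ∀ r ∈ q.roots, CauchyStable S r) (hs' : ∀ r ∈ q.roots, r.im ≠ 0)
    (hp : p.degree < q.degree) (v : C2) :
    Represents S fun x => (p.eval (x : ℂ) / q.eval (x : ℂ)) • v := by
  have hq0 : q ≠ 0 := by rintro rfl; simp at hp
  have hsplit := IsAlgClosed.splits q
  have hcard : (q.roots.card : WithBot ℕ) = q.degree := by
    rw [degree_eq_natDegree hq0, hsplit.natDegree_eq_card_roots]
  refine ((CauchyStable.represents_prod q.roots hs hs' p (by rw [hcard]; exact hp)
    v).smul q.leadingCoeff⁻¹).congr fun x => ?_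
  conv_rhs => rw [hsplit.eq_prod_roots]
  rw [smul_smul, eval_mul, eval_C]
  congr 1
  rw [mul_comm, mul_comm q.leadingCoeff, div_mul_eq_div_div, ← div_eq_mul_inv]

/-- The function `x ↦ (p₁(x), p₂(x)) / q(x)`. -/
def ratVec (p₁ p₂ q : ℂ[X]) : ℝ → C2 := fun x =>
  !₂[p₁.eval (x : ℂ) / q.eval (x : ℂ), p₂.eval (x : ℂ) / q.eval (x : ℂ)]

theorem CauchyStable.represents_ratVec {S : Submodule ℂ L2} {p₁ p₂ q : ℂ[X]}
    (hs : ∀ r ∈ q.roots, CauchyStable S r) (hs' : ∀ r ∈ q.roots, r.im ≠ 0)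
    (h₁ : p₁.degree < q.degree) (h₂ : p₂.degree < q.degree) :
    Represents S (ratVec p₁ p₂ q) := by
  refine ((CauchyStable.represents_div hs hs' h₁ !₂[1, 0]).add
    (CauchyStable.represents_div hs hs' h₂ !₂[0, 1])).congr fun x => ?_
  ext i
  fin_cases i <;> simp [ratVec]

theorem represents_hardy_ratVec {p₁ p₂ q : ℂ[X]} (hq : ∀ r ∈ q.roots, r.im < 0)
    (h₁ : p₁.degree < q.degree) (h₂ : p₂.degree < q.degree) :
    Represents hardy (ratVec p₁ p₂ q) :=
  CauchyStable.represents_ratVec (fun r hr => cauchyStable_hardy (hq r hr))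
    (fun r hr => (hq r hr).ne) h₁ h₂

theorem represents_hardy_orthogonal_ratVec {p₁ p₂ q : ℂ[X]} (hq : ∀ r ∈ q.roots, 0 < r.im)
    (h₁ : p₁.degree < q.degree) (h₂ : p₂.degree < q.degree) :
    Represents hardyᗮ (ratVec p₁ p₂ q) :=
  CauchyStable.represents_ratVec (fun r hr => cauchyStable_hardy_orthogonal (hq r hr))
    (fun r hr => (hq r hr).ne') h₁ h₂

/-! ### Conjugate polynomials -/

/-- The polynomial whose coefficients are the complex conjugates of those of `P`. -/
def conjPoly (P : ℂ[X]) : ℂ[X] := P.map (starRingEnd ℂ)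

theorem conjPoly_conjPoly (P : ℂ[X]) : conjPoly (conjPoly P) = P := by
  ext n
  simp [conjPoly]

theorem conjPoly_mul (P Q : ℂ[X]) : conjPoly (P * Q) = conjPoly P * conjPoly Q :=
  Polynomial.map_mul _

theorem conjPoly_add (P Q : ℂ[X]) : conjPoly (P + Q) = conjPoly P + conjPoly Q :=
  Polynomial.map_add _

theorem conjPoly_sub (P Q : ℂ[X]) : conjPoly (P - Q) = conjPoly P - conjPoly Q :=
  Polynomial.map_sub _

theorem conjPoly_C (c : ℂ) : conjPoly (C c) = C ((starRingEnd ℂ) c) := Polynomial.map_C _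

theorem conjPoly_map_ofReal (p : ℝ[X]) :
    conjPoly (p.map Complex.ofRealHom) = p.map Complex.ofRealHom := by
  ext n
  simp [conjPoly]

theorem natDegree_conjPoly (P : ℂ[X]) : (conjPoly P).natDegree = P.natDegree :=
  natDegree_map_eq_of_injective (starRingEnd ℂ).injective P

theorem eval_conjPoly (P : ℂ[X]) (x : ℝ) :
    (conjPoly P).eval (x : ℂ) = (starRingEnd ℂ) (P.eval (x : ℂ)) := by
  have h := Polynomial.eval_map_apply (f := starRingEnd ℂ) (p := P) (x := (x : ℂ))
  simpa [conjPoly] using h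

theorem eval_map_ofReal (p : ℝ[X]) (x : ℝ) :
    (p.map Complex.ofRealHom).eval (x : ℂ) = ((p.eval x : ℝ) : ℂ) := by
  have h := Polynomial.eval_map_apply (f := Complex.ofRealHom) (p := p) (x := x)
  simpa using h

theorem isCoprime_conjPoly {P Q : ℂ[X]} (h : IsCoprime P Q) :
    IsCoprime (conjPoly P) (conjPoly Q) :=
  h.map (mapRingHom (starRingEnd ℂ))

theorem eq_of_eval_ofReal_eq {p q : ℂ[X]} (h : ∀ x : ℝ, p.eval (x : ℂ) = q.eval (x : ℂ)) :
    p = q := by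
  refine Polynomial.eq_of_infinite_eval_eq p q ?_
  refine (Set.infinite_range_of_injective Complex.ofReal_injective).mono ?_
  rintro _ ⟨x, rfl⟩
  exact h x

theorem exists_real_of_conjPoly_eq {F : ℂ[X]} (h : conjPoly F = F) :
    ∃ G : ℝ[X], G.map Complex.ofRealHom = F := by
  refine (Polynomial.mem_lifts F).1 ((Polynomial.lifts_iff_coeff_lifts F).2 fun n => ?_)
  have h1 := congrArg (fun p => p.coeff n) h
  simp only [conjPoly, coeff_map] at h1
  obtain ⟨r, hr⟩ := Complex.conj_eq_iff_real.1 h1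
  exact ⟨r, hr.symm⟩

/-! ### Spinor representation of rational maps into the sphere -/

/-- The polynomial `|P|² + |Q|²` (on the real line). -/
def spinDen (P Q : ℂ[X]) : ℂ[X] := P * conjPoly P + Q * conjPoly Q

/-- The map `v` is the inverse stereographic image of `P / Q`, written without denominators. -/
def IsSpinor (v : ℝ → R3) (P Q : ℂ[X]) : Prop := ∀ x : ℝ,
  (spinDen P Q).eval (x : ℂ) * ((v x 0 : ℂ) + Complex.I * (v x 1 : ℂ)) =
      2 * P.eval (x : ℂ) * (starRingEnd ℂ) (Q.eval (x : ℂ)) ∧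
  (spinDen P Q).eval (x : ℂ) * (v x 2 : ℂ) =
    P.eval (x : ℂ) * (starRingEnd ℂ) (P.eval (x : ℂ)) -
      Q.eval (x : ℂ) * (starRingEnd ℂ) (Q.eval (x : ℂ))

theorem conjPoly_spinDen (P Q : ℂ[X]) : conjPoly (spinDen P Q) = spinDen P Q := by
  rw [spinDen, conjPoly_add, conjPoly_mul, conjPoly_mul, conjPoly_conjPoly, conjPoly_conjPoly]
  ring

theorem spinDen_eval (P Q : ℂ[X]) (x : ℝ) : (spinDen P Q).eval (x : ℂ) =
    ((Complex.normSq (P.eval (x : ℂ)) + Complex.normSq (Q.eval (x : ℂ)) : ℝ) : ℂ) := by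
  rw [spinDen, eval_add, eval_mul, eval_mul, eval_conjPoly, eval_conjPoly, Complex.mul_conj,
    Complex.mul_conj]
  push_cast
  rfl

theorem normSq_add_pos_of_isCoprime {P Q : ℂ[X]} (h : IsCoprime P Q) (z : ℂ) :
    0 < Complex.normSq (P.eval z) + Complex.normSq (Q.eval z) := by
  by_contra hneg
  have h1 := Complex.normSq_nonneg (P.eval z)
  have h2 := Complex.normSq_nonneg (Q.eval z)
  have e1 : P.eval z = 0 := Complex.normSq_eq_zero.1 (by linarith)
  have e2 : Q.eval z = 0 := Complex.normSq_eq_zero.1 (by linarith)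
  obtain ⟨a, b, hab⟩ := h
  have := congrArg (fun p => p.eval z) hab
  simp [e1, e2] at this

theorem spinDen_eval_ne_zero {P Q : ℂ[X]} (h : IsCoprime P Q) (x : ℝ) :
    (spinDen P Q).eval (x : ℂ) ≠ 0 := by
  rw [spinDen_eval]
  exact_mod_cast (normSq_add_pos_of_isCoprime h x).ne'

theorem spinDen_ne_zero {P Q : ℂ[X]} (h : IsCoprime P Q) : spinDen P Q ≠ 0 := by
  intro h0
  have := spinDen_eval_ne_zero h 0
  simp [h0] at this

theorem coeff_mul_conjPoly {P : ℂ[X]} {M : ℕ} (h : P.natDegree ≤ M) :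
    (P * conjPoly P).coeff (M + M) = (Complex.normSq (P.coeff M) : ℂ) := by
  rw [coeff_mul_add_eq_of_natDegree_le h (by rwa [natDegree_conjPoly]), conjPoly, coeff_map,
    Complex.mul_conj]

/-- The coefficient of degree `2M` is `|p_M|² + |q_M|²`. If it vanished, the polynomial of degree
`M` would be zero, so `M = 0` and both would be zero, against coprimality. -/
theorem natDegree_spinDen {P Q : ℂ[X]} (h : IsCoprime P Q) :
    (spinDen P Q).natDegree = 2 * max P.natDegree Q.natDegree := by
  set M := max P.natDegree Q.natDegree with hM
  have hP : P.natDegree ≤ M := le_max_left _ _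
  have hQ : Q.natDegree ≤ M := le_max_right _ _
  refine natDegree_eq_of_le_of_coeff_ne_zero ?_ ?_
  · refine natDegree_add_le_of_degree_le ?_ ?_
    · exact natDegree_mul_le.trans (by rw [natDegree_conjPoly]; omega)
    · exact natDegree_mul_le.trans (by rw [natDegree_conjPoly]; omega)
  · rw [two_mul, spinDen, coeff_add, coeff_mul_conjPoly hP, coeff_mul_conjPoly hQ]
    norm_cast
    intro h0
    have h1 := Complex.normSq_nonneg (P.coeff M)
    have h2 := Complex.normSq_nonneg (Q.coeff M)
    have e1 : P.coeff M = 0 := Complex.normSq_eq_zero.1 (by linarith)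
    have e2 : Q.coeff M = 0 := Complex.normSq_eq_zero.1 (by linarith)
    rcases max_choice P.natDegree Q.natDegree with hm | hm
    · rw [← hM] at hm
      rw [hm, coeff_natDegree, leadingCoeff_eq_zero] at e1
      have hM0 : M = 0 := by rw [hm, e1, natDegree_zero]
      have hQ0 : Q = 0 := by
        rw [eq_C_of_natDegree_le_zero (p := Q) (by omega), ← hM0, e2, C_0]
      rw [e1, hQ0] at h
      exact not_isCoprime_zero_zero h
    · rw [← hM] at hm
      rw [hm, coeff_natDegree, leadingCoeff_eq_zero] at e2
      have hM0 : M = 0 := by rw [hm, e2, natDegree_zero]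
      have hP0 : P = 0 := by
        rw [eq_C_of_natDegree_le_zero (p := P) (by omega), ← hM0, e1, C_0]
      rw [e2, hP0] at h
      exact not_isCoprime_zero_zero h

theorem sphere_sq_add (v : S2) : (v : R3) 0 ^ 2 + (v : R3) 1 ^ 2 + (v : R3) 2 ^ 2 = 1 := by
  have h := norm_eq_of_mem_sphere v
  have h2 := EuclideanSpace.norm_sq_eq (v : R3)
  rw [h, Fin.sum_univ_three] at h2
  simpa using h2.symm

theorem IsRational.exists_common_denominator {u : ℝ → S2} (hu : IsRational u) :
    ∃ (D : ℝ[X]) (p : Fin 3 → ℝ[X]), (∀ x, D.eval x ≠ 0) ∧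
      ∀ j x, D.eval x * (u x : R3) j = (p j).eval x := by
  choose p q h using hu
  refine ⟨∏ j, q j, fun j => p j * ∏ k ∈ Finset.univ.erase j, q k, fun x => ?_, fun j x => ?_⟩
  · rw [eval_prod]
    exact Finset.prod_ne_zero_iff.2 fun j _ => (h j x).1
  · rw [(h j x).2, ← Finset.mul_prod_erase _ _ (Finset.mem_univ j), eval_mul, eval_mul]
    have := (h j x).1
    field_simp

theorem exists_eq_mul_isCoprime (W : ℂ[X]) {T : ℂ[X]} (hT : T ≠ 0) :
    ∃ g P Q : ℂ[X], IsCoprime P Q ∧ W = g * P ∧ T = g * Q := by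
  obtain ⟨P, hP⟩ := EuclideanDomain.gcd_dvd_left W T
  obtain ⟨Q, hQ⟩ := EuclideanDomain.gcd_dvd_right W T
  have hab := EuclideanDomain.gcd_eq_gcd_ab W T
  set g := EuclideanDomain.gcd W T
  have hg : g ≠ 0 := by
    intro h
    rw [h, zero_mul] at hQ
    exact hT hQ
  refine ⟨g, P, Q, ⟨EuclideanDomain.gcdA W T, EuclideanDomain.gcdB W T, ?_⟩, hP, hQ⟩
  apply mul_left_cancel₀ hg
  linear_combination -hab - EuclideanDomain.gcdA W T * hP - EuclideanDomain.gcdB W T * hQ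

/-- Stereographic projection from `e₃` sends `u` to `(u₁ + i u₂) / (1 - u₃) = W / T`, and `P / Q` is
this quotient in lowest terms. The sphere equation becomes `W W̄ = T (D + p₂)`. -/
theorem exists_isSpinor {u : ℝ → S2} (hu : IsRational u) :
    ∃ P Q : ℂ[X], IsCoprime P Q ∧ IsSpinor (fun x => (u x : R3)) P Q := by
  obtain ⟨D, p, hD, hp⟩ := hu.exists_common_denominator
  set ι := Complex.ofRealHom
  set W : ℂ[X] := (p 0).map ι + C Complex.I * (p 1).map ι with hW
  set T : ℂ[X] := D.map ι - (p 2).map ι with hT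
  have hTc : conjPoly T = T := by
    rw [hT, conjPoly_sub, conjPoly_map_ofReal, conjPoly_map_ofReal]
  have hWc : conjPoly W = (p 0).map ι - C Complex.I * (p 1).map ι := by
    rw [hW, conjPoly_add, conjPoly_mul, conjPoly_map_ofReal, conjPoly_map_ofReal, conjPoly_C,
      Complex.conj_I, C_neg]
    ring
  have hsum : (p 0) ^ 2 + (p 1) ^ 2 + (p 2) ^ 2 = D ^ 2 := by
    refine Polynomial.funext fun x => ?_
    simp only [eval_add, eval_pow, ← hp]
    linear_combination (D.eval x) ^ 2 * sphere_sq_add (u x)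
  have hsum' := congrArg (Polynomial.map ι) hsum
  simp only [Polynomial.map_add, Polynomial.map_pow] at hsum'
  have hI : (C Complex.I : ℂ[X]) ^ 2 = -1 := by rw [← C_pow, Complex.I_sq]; simp
  have hWW : W * conjPoly W = T * (D.map ι + (p 2).map ι) := by
    rw [hWc, hW, hT]
    linear_combination hsum' - ((p 1).map ι) ^ 2 * hI
  -- Here `u` is constantly `e₃`, the image of infinity.
  by_cases hT0 : T = 0
  · refine ⟨1, 0, isCoprime_one_left, fun x => ?_⟩
    have h2 : (p 2).eval x = D.eval x := by
      have := congrArg (fun q => q.eval (x : ℂ)) hT0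
      simp only [hT, eval_sub, ι, eval_map_ofReal, eval_zero] at this
      rw [sub_eq_zero] at this
      exact_mod_cast this.symm
    have h3 : (u x : R3) 2 = 1 := by
      have := hp 2 x
      rw [h2] at this
      exact mul_left_cancel₀ (hD x) (by rw [this, mul_one])
    have hs := sphere_sq_add (u x)
    rw [h3] at hs
    have h0 : (u x : R3) 0 = 0 := by nlinarith [sq_nonneg ((u x : R3) 0), sq_nonneg ((u x : R3) 1)]
    have h1 : (u x : R3) 1 = 0 := by nlinarith [sq_nonneg ((u x : R3) 0), sq_nonneg ((u x : R3) 1)]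
    simp [h0, h1, h3, spinDen, conjPoly]
  · obtain ⟨g, P, Q, hcop, hP, hQ⟩ := exists_eq_mul_isCoprime W hT0
    have hg : g ≠ 0 := by
      intro h
      rw [h, zero_mul] at hQ
      exact hT0 hQ
    have hgc : conjPoly g ≠ 0 := fun h => hg (by rw [← conjPoly_conjPoly g, h]; simp [conjPoly])
    have hPc : conjPoly W = conjPoly g * conjPoly P := by
      conv_lhs => rw [hP]
      exact conjPoly_mul _ _
    have hQc : T = conjPoly g * conjPoly Q := by
      conv_lhs => rw [← hTc, hQ]
      exact conjPoly_mul _ _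
    -- After multiplication by `g ḡ`, both spinor identities become identities in `W` and the real
    -- polynomial `T`; they follow from `W W̄ + T² = 2 D T`.
    have e1 : W * conjPoly W = (g * P) * (conjPoly g * conjPoly P) := by rw [← hP, ← hPc]
    have e2 : T * T = (g * Q) * (conjPoly g * conjPoly Q) := by rw [← hQ, ← hQc]
    have e3 : W * T = (g * P) * (conjPoly g * conjPoly Q) := by rw [← hP, ← hQc]
    have key1 : spinDen P Q * W = 2 * P * conjPoly Q * D.map ι := by
      apply mul_left_cancel₀ (mul_ne_zero hg hgc)
      rw [spinDen]
      linear_combination 2 * D.map ι * e3 - W * e1 - W * e2 + W * hWW + W * T * hT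
    have key2 : spinDen P Q * (p 2).map ι = (P * conjPoly P - Q * conjPoly Q) * D.map ι := by
      apply mul_left_cancel₀ (mul_ne_zero hg hgc)
      rw [spinDen]
      linear_combination ((p 2).map ι - D.map ι) * (hWW - e1) +
        ((p 2).map ι + D.map ι) * (T * hT - e2)
    refine ⟨P, Q, hcop, fun x => ⟨?_, ?_⟩⟩
    · have hx : ((D.eval x : ℝ) : ℂ) ≠ 0 := by exact_mod_cast hD x
      apply mul_left_cancel₀ hx
      have := congrArg (fun q => q.eval (x : ℂ)) key1
      simp only [eval_mul, hW, eval_add, ι, eval_map_ofReal, eval_C, ← hp, eval_conjPoly,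
        Complex.ofReal_mul, eval_ofNat] at this
      linear_combination this
    · have hx : ((D.eval x : ℝ) : ℂ) ≠ 0 := by exact_mod_cast hD x
      apply mul_left_cancel₀ hx
      have := congrArg (fun q => q.eval (x : ℂ)) key2
      simp only [eval_mul, eval_sub, ι, eval_map_ofReal, ← hp, eval_conjPoly,
        Complex.ofReal_mul] at this
      linear_combination this

/-! ### The least common denominator of a spinor -/

/-- Every `D vⱼ` is a polynomial. -/
def HasDen (v : ℝ → R3) (D : ℝ[X]) : Prop :=
  ∀ j : Fin 3, ∃ p : ℝ[X], ∀ x : ℝ, D.eval x * v x j = p.eval x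

theorem HasDen.mulVec {v : ℝ → R3} {D : ℝ[X]} (h : HasDen v D) (A : Matrix (Fin 3) (Fin 3) ℝ) :
    HasDen (fun x => Matrix.toEuclideanCLM (n := Fin 3) (𝕜 := ℝ) A (v x)) D := by
  choose p hp using h
  intro j
  refine ⟨∑ k, C (A j k) * p k, fun x => ?_⟩
  rw [Matrix.ofLp_toEuclideanCLM, Matrix.mulVec, dotProduct, eval_finsetSum, Finset.mul_sum]
  refine Finset.sum_congr rfl fun k _ => ?_
  rw [eval_mul, eval_C, ← hp]
  ring

theorem IsSpinor.conj {v : ℝ → R3} {P Q : ℂ[X]} (h : IsSpinor v P Q) (x : ℝ) :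
    (spinDen P Q).eval (x : ℂ) * ((v x 0 : ℂ) - Complex.I * (v x 1 : ℂ)) =
      2 * (starRingEnd ℂ) (P.eval (x : ℂ)) * Q.eval (x : ℂ) := by
  have h1 := congrArg (starRingEnd ℂ) (h x).1
  rw [spinDen_eval] at h1 ⊢
  simp only [map_mul, map_add, Complex.conj_ofReal, Complex.conj_I, Complex.conj_conj,
    Complex.conj_ofNat] at h1
  linear_combination h1

/-- The numerators are `2 Re (P Q̄)`, `2 Im (P Q̄)` and `P P̄ - Q Q̄`, each equal to its own
conjugate and hence real. -/
theorem IsSpinor.exists_hasDen {v : ℝ → R3} {P Q : ℂ[X]} (h : IsSpinor v P Q) :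
    ∃ E : ℝ[X], E.map Complex.ofRealHom = spinDen P Q ∧ HasDen v E := by
  obtain ⟨E, hE⟩ := exists_real_of_conjPoly_eq (conjPoly_spinDen P Q)
  refine ⟨E, hE, ?_⟩
  obtain ⟨p0, hp0⟩ := exists_real_of_conjPoly_eq (F := P * conjPoly Q + conjPoly P * Q) (by
    simp only [conjPoly_add, conjPoly_mul, conjPoly_conjPoly]; ring)
  obtain ⟨p1, hp1⟩ := exists_real_of_conjPoly_eq
    (F := C (-Complex.I) * (P * conjPoly Q - conjPoly P * Q)) (by
    rw [conjPoly_mul, conjPoly_C, map_neg, Complex.conj_I, neg_neg, C_neg]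
    simp only [conjPoly_sub, conjPoly_mul, conjPoly_conjPoly]
    ring)
  obtain ⟨p2, hp2⟩ := exists_real_of_conjPoly_eq (F := P * conjPoly P - Q * conjPoly Q) (by
    simp only [conjPoly_sub, conjPoly_mul, conjPoly_conjPoly]; ring)
  have hx : ∀ x : ℝ, ((E.eval x : ℝ) : ℂ) = (spinDen P Q).eval (x : ℂ) := fun x => by
    rw [← hE, eval_map_ofReal]
  intro j
  fin_cases j
  · refine ⟨p0, fun x => ?_⟩
    apply Complex.ofReal_injective
    rw [← eval_map_ofReal p0, hp0, Complex.ofReal_mul, hx]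
    simp only [eval_add, eval_mul, eval_conjPoly]
    have h1 := (h x).1
    have h2 := h.conj x
    simp only [Fin.zero_eta]
    linear_combination (h1 + h2) / 2
  · refine ⟨p1, fun x => ?_⟩
    apply Complex.ofReal_injective
    rw [← eval_map_ofReal p1, hp1, Complex.ofReal_mul, hx]
    simp only [eval_sub, eval_mul, eval_conjPoly, eval_C]
    have h1 := (h x).1
    have h2 := h.conj x
    simp only [Fin.mk_one]
    linear_combination (-Complex.I) * (h1 - h2) / 2 +
      (spinDen P Q).eval (x : ℂ) * (v x 1 : ℂ) * Complex.I_sq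
  · refine ⟨p2, fun x => ?_⟩
    apply Complex.ofReal_injective
    rw [← eval_map_ofReal p2, hp2, Complex.ofReal_mul, hx]
    simp only [eval_sub, eval_mul, eval_conjPoly]
    exact (h x).2

/-- The spinor equations show that `E = P P̄ + Q Q̄` divides `D` times each of `P P̄`, `P Q̄`, `P̄
Q`, `Q Q̄`, up to the invertible factor 2. The product `(a P + b Q)(a' P̄ + b' Q̄) = 1` writes 1 as
a combination of these four. -/
theorem IsSpinor.spinDen_dvd {v : ℝ → R3} {P Q : ℂ[X]} (h : IsSpinor v P Q)
    (hPQ : IsCoprime P Q) {D : ℝ[X]} (hD : HasDen v D) :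
    spinDen P Q ∣ D.map Complex.ofRealHom := by
  choose p hp using hD
  set ι := Complex.ofRealHom
  have hp' : ∀ j (x : ℝ), ((D.eval x : ℝ) : ℂ) * (v x j : ℂ) = (((p j).eval x : ℝ) : ℂ) :=
    fun j x => by rw [← Complex.ofReal_mul, hp]
  have k1 : spinDen P Q * ((p 0).map ι + C Complex.I * (p 1).map ι) =
      2 * P * conjPoly Q * D.map ι := by
    refine eq_of_eval_ofReal_eq fun x => ?_
    simp only [eval_mul, eval_add, ι, eval_map_ofReal, eval_C, eval_conjPoly, ← hp', eval_ofNat]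
    linear_combination ((D.eval x : ℝ) : ℂ) * (h x).1
  have k2 : spinDen P Q * ((p 0).map ι - C Complex.I * (p 1).map ι) =
      2 * conjPoly P * Q * D.map ι := by
    refine eq_of_eval_ofReal_eq fun x => ?_
    simp only [eval_mul, eval_sub, ι, eval_map_ofReal, eval_C, eval_conjPoly, ← hp', eval_ofNat]
    linear_combination ((D.eval x : ℝ) : ℂ) * h.conj x
  have k3 : spinDen P Q * (p 2).map ι = (P * conjPoly P - Q * conjPoly Q) * D.map ι := by
    refine eq_of_eval_ofReal_eq fun x => ?_
    simp only [eval_mul, eval_sub, ι, eval_map_ofReal, eval_conjPoly, ← hp']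
    linear_combination ((D.eval x : ℝ) : ℂ) * (h x).2
  obtain ⟨a, b, hab⟩ := hPQ
  obtain ⟨a', b', hab'⟩ := isCoprime_conjPoly ⟨a, b, hab⟩
  have h2 : (C (1 / 2) : ℂ[X]) * 2 = 1 := by
    rw [show (2 : ℂ[X]) = C 2 from rfl, ← C_mul]; norm_num
  refine ⟨C (1 / 2) * (a * a' * (D.map ι + (p 2).map ι) + b * b' * (D.map ι - (p 2).map ι) +
    a * b' * ((p 0).map ι + C Complex.I * (p 1).map ι) +
    b * a' * ((p 0).map ι - C Complex.I * (p 1).map ι)), ?_⟩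
  have e : D.map ι = D.map ι * ((a * P + b * Q) * (a' * conjPoly P + b' * conjPoly Q)) := by
    rw [hab, hab']; ring
  have k4 : spinDen P Q * D.map ι = (P * conjPoly P + Q * conjPoly Q) * D.map ι := rfl
  linear_combination e - (D.map ι * ((a * P + b * Q) * (a' * conjPoly P + b' * conjPoly Q))) * h2 -
    C (1 / 2) * (a * a' * (k4 + k3) + b * b' * (k4 - k3) + a * b' * k1 + b * a' * k2)

theorem natDegree_eq_of_map_eq_spinDen {P Q : ℂ[X]} (hPQ : IsCoprime P Q) {E : ℝ[X]}
    (hE : E.map Complex.ofRealHom = spinDen P Q) :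
    E.natDegree = 2 * max P.natDegree Q.natDegree := by
  rw [← natDegree_spinDen hPQ, ← hE, natDegree_map_eq_of_injective Complex.ofReal_injective]

/-- An invertible constant matrix does not change the set of common denominators, so the spinor of
any rotated map determines the least one for `u`. -/
theorem exists_isLeastCommonDenominator {u : ℝ → S2} {A B : Matrix (Fin 3) (Fin 3) ℝ}
    (hBA : B * A = 1) {P Q : ℂ[X]} (hPQ : IsCoprime P Q)
    (h : IsSpinor (fun x => Matrix.toEuclideanCLM (n := Fin 3) (𝕜 := ℝ) A (u x)) P Q) :
    ∃ E : ℝ[X], IsLeastCommonDenominator u E ∧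
      E.natDegree = 2 * max P.natDegree Q.natDegree := by
  obtain ⟨E, hE, hden⟩ := h.exists_hasDen
  refine ⟨E, ⟨⟨?_, ?_⟩, fun D hD => ?_⟩, natDegree_eq_of_map_eq_spinDen hPQ hE⟩
  · rintro rfl
    exact spinDen_ne_zero hPQ (by rw [← hE, Polynomial.map_zero])
  · have h1 := hden.mulVec B
    have h2 : ∀ y : R3, Matrix.toEuclideanCLM (n := Fin 3) (𝕜 := ℝ) B
        (Matrix.toEuclideanCLM (n := Fin 3) (𝕜 := ℝ) A y) = y := fun y => by
      rw [← mul_apply_eq_comp, ← map_mul, hBA, map_one]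
      rfl
    simp only [h2] at h1
    exact h1
  · have h1 : HasDen (fun x => (u x : R3)) D := hD.2
    have h2 := h.spinDen_dvd hPQ (h1.mulVec A)
    rw [← hE] at h2
    exact (map_dvd_map' Complex.ofRealHom).1 h2

theorem IsLeastCommonDenominator.natDegree_eq {u : ℝ → S2} {D E : ℝ[X]}
    (hD : IsLeastCommonDenominator u D) (hE : IsLeastCommonDenominator u E) :
    D.natDegree = E.natDegree :=
  le_antisymm (natDegree_le_of_dvd (hD.2 E hE.1) hE.1.1) (natDegree_le_of_dvd (hE.2 D hD.1) hD.1.1)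

/-! ### Rotations -/

/-- The rotation matrix of the unit quaternion `(α, β)`. -/
def spinRot (α β : ℂ) : Matrix (Fin 3) (Fin 3) ℝ :=
  !![(α ^ 2 - β ^ 2).re, -(α ^ 2 + β ^ 2).im, -2 * (α * β).re;
     (α ^ 2 - β ^ 2).im, (α ^ 2 + β ^ 2).re, -2 * (α * β).im;
     2 * (α * (starRingEnd ℂ) β).re, -2 * (α * (starRingEnd ℂ) β).im,
       Complex.normSq α - Complex.normSq β]

theorem spinRot_mem {α β : ℂ} (h : Complex.normSq α + Complex.normSq β = 1) :
    spinRot α β ∈ Matrix.specialOrthogonalGroup (Fin 3) ℝ := by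
  obtain ⟨a, b⟩ := α
  obtain ⟨c, d⟩ := β
  simp only [Complex.normSq_apply] at h
  rw [Matrix.mem_specialOrthogonalGroup_iff, Matrix.mem_orthogonalGroup_iff]
  -- The entries of `A Aᵀ` are quartic in the real coordinates of `α` and `β`, and the determinant
  -- is sextic; hence the square and the cube of the norm equation.
  have e2 : (a * a + b * b + (c * c + d * d)) ^ 2 = 1 := by rw [h]; norm_num
  have e3 : (a * a + b * b + (c * c + d * d)) ^ 3 = 1 := by rw [h]; norm_num
  constructor
  · ext i j
    fin_cases i <;> fin_cases j <;>
      simp [spinRot, Matrix.mul_apply, Fin.sum_univ_three, pow_two, Complex.normSq_apply] <;>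
      first
      | linear_combination e2
      | ring
  · rw [Matrix.det_fin_three]
    simp [spinRot, pow_two, Complex.normSq_apply]
    linear_combination e3

theorem spinDen_rot {α β : ℂ} (h : Complex.normSq α + Complex.normSq β = 1) (P Q : ℂ[X]) :
    spinDen (C α * P + C β * Q) (C ((starRingEnd ℂ) α) * Q - C ((starRingEnd ℂ) β) * P) =
      spinDen P Q := by
  have h' : (C α * C ((starRingEnd ℂ) α) + C β * C ((starRingEnd ℂ) β) : ℂ[X]) = 1 := by
    rw [← C_mul, ← C_mul, Complex.mul_conj, Complex.mul_conj, ← C_add, ← Complex.ofReal_add, h]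
    simp
  simp only [spinDen, conjPoly_add, conjPoly_sub, conjPoly_mul, conjPoly_C, Complex.conj_conj]
  linear_combination (P * conjPoly P + Q * conjPoly Q) * h'

/-- This is the covering `SU(2) → SO(3)`: the matrix with rows `(α, β)` and `(-β̄, ᾱ)` acts on `(P,
Q)` and preserves `P P̄ + Q Q̄`. -/
theorem IsSpinor.rot {v : ℝ → R3} {P Q : ℂ[X]} (h : IsSpinor v P Q) {α β : ℂ}
    (hαβ : Complex.normSq α + Complex.normSq β = 1) :
    IsSpinor (fun x => Matrix.toEuclideanCLM (n := Fin 3) (𝕜 := ℝ) (spinRot α β) (v x))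
      (C α * P + C β * Q) (C ((starRingEnd ℂ) α) * Q - C ((starRingEnd ℂ) β) * P) := by
  intro x
  have h1 := (h x).1
  have h2 := h.conj x
  have h3 := (h x).2
  rw [spinDen_rot hαβ]
  simp only [Matrix.ofLp_toEuclideanCLM, Matrix.mulVec, dotProduct, Fin.sum_univ_three, eval_add,
    eval_sub, eval_mul, eval_C, map_add, map_sub, map_mul, Complex.conj_conj]
  set e := (spinDen P Q).eval (x : ℂ)
  set p := P.eval (x : ℂ)
  set q := Q.eval (x : ℂ)
  constructor
  · have key : ((((spinRot α β) 0 0 * v x 0 + (spinRot α β) 0 1 * v x 1 +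
          (spinRot α β) 0 2 * v x 2 : ℝ) : ℂ) + Complex.I * (((spinRot α β) 1 0 * v x 0 +
          (spinRot α β) 1 1 * v x 1 + (spinRot α β) 1 2 * v x 2 : ℝ) : ℂ)) =
        α ^ 2 * ((v x 0 : ℂ) + Complex.I * (v x 1 : ℂ)) -
          β ^ 2 * ((v x 0 : ℂ) - Complex.I * (v x 1 : ℂ)) - 2 * α * β * (v x 2 : ℂ) := by
      apply Complex.ext <;> simp [spinRot, pow_two] <;> ring
    rw [key]
    linear_combination α ^ 2 * h1 - β ^ 2 * h2 - 2 * α * β * h3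
  · have key : (((spinRot α β) 2 0 * v x 0 + (spinRot α β) 2 1 * v x 1 +
          (spinRot α β) 2 2 * v x 2 : ℝ) : ℂ) =
        α * (starRingEnd ℂ) β * ((v x 0 : ℂ) + Complex.I * (v x 1 : ℂ)) +
          (starRingEnd ℂ) α * β * ((v x 0 : ℂ) - Complex.I * (v x 1 : ℂ)) +
          (α * (starRingEnd ℂ) α - β * (starRingEnd ℂ) β) * (v x 2 : ℂ) := by
      apply Complex.ext <;> simp [spinRot, pow_two, Complex.normSq_apply] <;> ring
    rw [key]
    linear_combination α * (starRingEnd ℂ) β * h1 + (starRingEnd ℂ) α * β * h2 +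
      (α * (starRingEnd ℂ) α - β * (starRingEnd ℂ) β) * h3

theorem isCoprime_rot {α β : ℂ} (h : Complex.normSq α + Complex.normSq β = 1) {P Q : ℂ[X]}
    (hPQ : IsCoprime P Q) :
    IsCoprime (C α * P + C β * Q) (C ((starRingEnd ℂ) α) * Q - C ((starRingEnd ℂ) β) * P) := by
  have h' : (C α * C ((starRingEnd ℂ) α) + C β * C ((starRingEnd ℂ) β) : ℂ[X]) = 1 := by
    rw [← C_mul, ← C_mul, Complex.mul_conj, Complex.mul_conj, ← C_add, ← Complex.ofReal_add, h]
    simp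
  obtain ⟨a, b, hab⟩ := hPQ
  refine ⟨a * C ((starRingEnd ℂ) α) + b * C ((starRingEnd ℂ) β), b * C α - a * C β, ?_⟩
  linear_combination hab + (a * P + b * Q) * h'

/-- A spinor can be rotated so that its second component has smaller degree. -/
theorem IsSpinor.exists_rot {v : ℝ → R3} {P Q : ℂ[X]} (h : IsSpinor v P Q) (hPQ : IsCoprime P Q) :
    ∃ A ∈ Matrix.specialOrthogonalGroup (Fin 3) ℝ, ∃ P' Q' : ℂ[X], IsCoprime P' Q' ∧
      P'.degree = (max P.natDegree Q.natDegree : ℕ) ∧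
      Q'.degree < (max P.natDegree Q.natDegree : ℕ) ∧
      IsSpinor (fun x => Matrix.toEuclideanCLM (n := Fin 3) (𝕜 := ℝ) A (v x)) P' Q' := by
  set M := max P.natDegree Q.natDegree with hM
  have hP : P.natDegree ≤ M := le_max_left _ _
  have hQ : Q.natDegree ≤ M := le_max_right _ _
  set p := P.coeff M
  set q := Q.coeff M
  have hc : (spinDen P Q).coeff (2 * M) = ((Complex.normSq p + Complex.normSq q : ℝ) : ℂ) := by
    rw [two_mul, spinDen, coeff_add, coeff_mul_conjPoly hP, coeff_mul_conjPoly hQ]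
    push_cast; rfl
  have hpos : 0 < Complex.normSq p + Complex.normSq q := by
    refine lt_of_le_of_ne (add_nonneg (Complex.normSq_nonneg _) (Complex.normSq_nonneg _)) ?_
    intro h0
    rw [← h0, hM, ← natDegree_spinDen hPQ, coeff_natDegree, Complex.ofReal_zero,
      leadingCoeff_eq_zero] at hc
    exact spinDen_ne_zero hPQ hc
  set r := Real.sqrt (Complex.normSq p + Complex.normSq q)
  have hr : r ≠ 0 := (Real.sqrt_pos.2 hpos).ne'
  have hr2 : r * r = Complex.normSq p + Complex.normSq q := Real.mul_self_sqrt hpos.le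
  -- With these `α` and `β` the coefficient vector `(p, q)` of degree `M` is sent to `(r, 0)`.
  set α : ℂ := (starRingEnd ℂ) p / r with hα
  set β : ℂ := (starRingEnd ℂ) q / r with hβ
  have hαβ : Complex.normSq α + Complex.normSq β = 1 := by
    rw [hα, hβ, Complex.normSq_div, Complex.normSq_div, Complex.normSq_conj, Complex.normSq_conj,
      Complex.normSq_ofReal, ← add_div, hr2, div_self hpos.ne']
  have hdeg : ∀ a b : ℂ, (C a * P + C b * Q).natDegree ≤ M := fun a b =>
    natDegree_add_le_of_degree_le ((natDegree_C_mul_le _ _).trans hP)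
      ((natDegree_C_mul_le _ _).trans hQ)
  have hr' : (r : ℂ) ≠ 0 := by exact_mod_cast hr
  refine ⟨spinRot α β, spinRot_mem hαβ, _, _, isCoprime_rot hαβ hPQ, ?_, ?_, h.rot hαβ⟩
  · refine degree_eq_of_le_of_coeff_ne_zero (degree_le_of_natDegree_le (hdeg α β)) ?_
    have : (C α * P + C β * Q).coeff M = r := by
      rw [coeff_add, coeff_C_mul, coeff_C_mul]
      have hr3 : (r : ℂ) * r = p * (starRingEnd ℂ) p + q * (starRingEnd ℂ) q := by
        rw [Complex.mul_conj, Complex.mul_conj]; exact_mod_cast hr2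
      rw [hα, hβ]
      field_simp
      linear_combination -hr3
    rw [this]
    exact hr'
  · have hle : (C ((starRingEnd ℂ) α) * Q - C ((starRingEnd ℂ) β) * P).natDegree ≤ M := by
      have := hdeg (-(starRingEnd ℂ) β) ((starRingEnd ℂ) α)
      rwa [C_neg, neg_mul, neg_add_eq_sub] at this
    rw [degree_lt_iff_coeff_zero]
    intro m hm
    rcases hm.lt_or_eq with hm | rfl
    · exact coeff_eq_zero_of_natDegree_lt (hle.trans_lt hm)
    · rw [coeff_sub, coeff_C_mul, coeff_C_mul, hα, hβ]
      simp only [map_div₀, Complex.conj_conj, Complex.conj_ofReal]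
      ring

/-! ### Stereographic projection of rational functions -/

/-- `ratValue` refers to the normalized fraction. Cross-multiplication and coprimality of both
representations show that their denominators have the same real zeros. -/
theorem ratValue_div {P Q : ℂ[X]} (hPQ : IsCoprime P Q) (hQ : Q ≠ 0) (x : ℝ) :
    ratValue (algebraMap ℂ[X] (RatFunc ℂ) P / algebraMap ℂ[X] (RatFunc ℂ) Q) x =
      open Classical in if Q.eval (x : ℂ) = 0 then OnePoint.infty
        else ((P.eval (x : ℂ) / Q.eval (x : ℂ) : ℂ) : OnePoint ℂ) := by
  set R := algebraMap ℂ[X] (RatFunc ℂ) P / algebraMap ℂ[X] (RatFunc ℂ) Q with hR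
  have h1 : R.num * Q = P * R.denom := (RatFunc.num_mul_eq_mul_denom_iff hQ).2 hR
  have h2 := congrArg (fun p => p.eval (x : ℂ)) h1
  simp only [eval_mul] at h2
  have hcop := RatFunc.isCoprime_num_denom R
  have n1 := normSq_add_pos_of_isCoprime hcop x
  have n2 := normSq_add_pos_of_isCoprime hPQ x
  have hiff : R.denom.eval (x : ℂ) = 0 ↔ Q.eval (x : ℂ) = 0 := by
    constructor
    · intro h
      rw [h, mul_zero] at h2
      refine (mul_eq_zero.1 h2).resolve_left fun h3 => ?_
      simp [h, h3] at n1
    · intro h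
      rw [h, mul_zero] at h2
      refine (mul_eq_zero.1 h2.symm).resolve_left fun h3 => ?_
      simp [h, h3] at n2
  unfold ratValue
  by_cases h : Q.eval (x : ℂ) = 0
  · rw [if_pos (hiff.2 h), if_pos h]
  · have h' : R.denom.eval (x : ℂ) ≠ 0 := fun h0 => h (hiff.1 h0)
    rw [if_neg h', if_neg h]
    congr 1
    rw [RatFunc.eval, eval₂_id, eval₂_id, div_eq_div_iff h' h, h2]

theorem eq_invStereo_iff_infty {p : ℂ} (hp : p ≠ 0) (y : R3) :
    y = invStereo OnePoint.infty ↔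
      ((Complex.normSq p : ℝ) : ℂ) * ((y 0 : ℂ) + Complex.I * (y 1 : ℂ)) = 0 ∧
      ((Complex.normSq p : ℝ) : ℂ) * (y 2 : ℂ) = (Complex.normSq p : ℝ) := by
  have hn : ((Complex.normSq p : ℝ) : ℂ) ≠ 0 := by
    exact_mod_cast (Complex.normSq_pos.2 hp).ne'
  have hinv : invStereo OnePoint.infty = !₂[0, 0, 1] := rfl
  rw [hinv, mul_eq_zero, or_iff_right hn, mul_eq_left₀ hn]
  constructor
  · rintro rfl
    simp
  · rintro ⟨h1, h2⟩
    have e0 : y 0 = 0 := by simpa using congrArg Complex.re h1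
    have e1 : y 1 = 0 := by simpa using congrArg Complex.im h1
    have e2 : y 2 = 1 := by exact_mod_cast h2
    ext j
    fin_cases j <;> simp [e0, e1, e2]

theorem eq_invStereo_iff_coe {p q : ℂ} (hq : q ≠ 0) (y : R3) :
    y = invStereo ((p / q : ℂ) : OnePoint ℂ) ↔
      ((Complex.normSq p + Complex.normSq q : ℝ) : ℂ) * ((y 0 : ℂ) + Complex.I * (y 1 : ℂ)) =
        2 * p * (starRingEnd ℂ) q ∧
      ((Complex.normSq p + Complex.normSq q : ℝ) : ℂ) * (y 2 : ℂ) =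
        p * (starRingEnd ℂ) p - q * (starRingEnd ℂ) q := by
  have hn := Complex.normSq_pos.2 hq
  have hE : Complex.normSq p + Complex.normSq q ≠ 0 := by
    have := Complex.normSq_nonneg p
    linarith
  have hden : Complex.normSq (p / q) + 1 =
      (Complex.normSq p + Complex.normSq q) / Complex.normSq q := by
    rw [Complex.normSq_div]; field_simp
  have hinv : invStereo ((p / q : ℂ) : OnePoint ℂ) =
      !₂[2 * (p * (starRingEnd ℂ) q).re / (Complex.normSq p + Complex.normSq q),
        2 * (p * (starRingEnd ℂ) q).im / (Complex.normSq p + Complex.normSq q),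
        (Complex.normSq p - Complex.normSq q) / (Complex.normSq p + Complex.normSq q)] := by
    have hd : p / q = (p * (starRingEnd ℂ) q) * ((Complex.normSq q)⁻¹ : ℝ) := by
      rw [div_eq_mul_inv, Complex.inv_def, mul_assoc]
    have hre : (p / q).re = (p * (starRingEnd ℂ) q).re / Complex.normSq q := by
      rw [hd, Complex.re_mul_ofReal, div_eq_mul_inv]
    have him : (p / q).im = (p * (starRingEnd ℂ) q).im / Complex.normSq q := by
      rw [hd, Complex.im_mul_ofReal, div_eq_mul_inv]
    have h0 : invStereo ((p / q : ℂ) : OnePoint ℂ) =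
      !₂[2 * (p / q).re / (Complex.normSq (p / q) + 1),
        2 * (p / q).im / (Complex.normSq (p / q) + 1),
        (Complex.normSq (p / q) - 1) / (Complex.normSq (p / q) + 1)] := rfl
    rw [h0, hden, hre, him, Complex.normSq_div]
    ext j
    fin_cases j <;> simp <;> field_simp
  have e1 : (((Complex.normSq p + Complex.normSq q : ℝ) : ℂ) *
      ((y 0 : ℂ) + Complex.I * (y 1 : ℂ)) = 2 * p * (starRingEnd ℂ) q) ↔
      (Complex.normSq p + Complex.normSq q) * y 0 = 2 * (p * (starRingEnd ℂ) q).re ∧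
      (Complex.normSq p + Complex.normSq q) * y 1 = 2 * (p * (starRingEnd ℂ) q).im := by
    rw [Complex.ext_iff, Complex.re_ofReal_mul, Complex.im_ofReal_mul, mul_assoc]
    simp
  have e2 : (((Complex.normSq p + Complex.normSq q : ℝ) : ℂ) * (y 2 : ℂ) =
        p * (starRingEnd ℂ) p - q * (starRingEnd ℂ) q) ↔
      (Complex.normSq p + Complex.normSq q) * y 2 = Complex.normSq p - Complex.normSq q := by
    rw [Complex.mul_conj, Complex.mul_conj]
    norm_cast
  rw [hinv, e1, e2, and_assoc]
  constructor
  · rintro rfl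
    simp
    refine ⟨?_, ?_, ?_⟩ <;> field_simp
  · rintro ⟨h1, h2, h3⟩
    ext j
    fin_cases j
    · exact (eq_div_iff hE).2 ((mul_comm _ _).trans h1)
    · exact (eq_div_iff hE).2 ((mul_comm _ _).trans h2)
    · exact (eq_div_iff hE).2 ((mul_comm _ _).trans h3)

theorem isSpinor_iff_eq_invStereo {P Q : ℂ[X]} (hPQ : IsCoprime P Q) (hQ : Q ≠ 0) (v : ℝ → R3) :
    IsSpinor v P Q ↔ ∀ x, v x = invStereo
      (ratValue (algebraMap ℂ[X] (RatFunc ℂ) P / algebraMap ℂ[X] (RatFunc ℂ) Q) x) := by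
  refine forall_congr' fun x => ?_
  rw [ratValue_div hPQ hQ, spinDen_eval]
  by_cases h : Q.eval (x : ℂ) = 0
  · have hp : P.eval (x : ℂ) ≠ 0 := by
      intro h0
      have := normSq_add_pos_of_isCoprime hPQ x
      simp [h, h0] at this
    rw [if_pos h, eq_invStereo_iff_infty hp, h]
    simp [Complex.mul_conj]
  · rw [if_neg h, eq_invStereo_iff_coe h]

/-! ### Splitting the denominator along the real line -/

/-- A factorization `|P|² + |Q|² = E₊ E₋` into factors of degree `M` with zeros in the upper and in
the lower half-plane respectively. -/
structure HalfPlaneFactors (P Q Ep Em : ℂ[X]) (M : ℕ) : Prop where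
  isCoprime : IsCoprime P Q
  eq_mul : spinDen P Q = Ep * Em
  monic : Ep.Monic
  degree_upper : Ep.degree = M
  degree_lower : Em.degree = M
  im_pos : ∀ r ∈ Ep.roots, 0 < r.im
  im_neg : ∀ r ∈ Em.roots, r.im < 0
  degree_left : P.degree ≤ M
  degree_right : Q.degree ≤ M

theorem roots_spinDen_conj (P Q : ℂ[X]) :
    (spinDen P Q).roots.map (starRingEnd ℂ) = (spinDen P Q).roots := by
  have h := (IsAlgClosed.splits (spinDen P Q)).roots_map (starRingEnd ℂ)
  have h2 : (spinDen P Q).map (starRingEnd ℂ) = spinDen P Q := conjPoly_spinDen P Q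
  rw [h2] at h
  exact h.symm

theorem im_ne_zero_of_mem_roots_spinDen {P Q : ℂ[X]} (hPQ : IsCoprime P Q) {r : ℂ}
    (hr : r ∈ (spinDen P Q).roots) : r.im ≠ 0 := by
  intro h0
  have h1 : (spinDen P Q).eval r = 0 := isRoot_of_mem_roots hr
  have h2 : r = (r.re : ℂ) := Complex.ext (by simp) (by simp [h0])
  rw [h2] at h1
  exact spinDen_eval_ne_zero hPQ r.re h1

/-- Conjugation permutes the roots of `E` with multiplicity, and none is real, so exactly half of
the `2M` roots lie in each half-plane. -/
theorem exists_halfPlaneFactors {P Q : ℂ[X]} (hPQ : IsCoprime P Q) :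
    ∃ Ep Em : ℂ[X], HalfPlaneFactors P Q Ep Em (max P.natDegree Q.natDegree) := by
  classical
  set E := spinDen P Q with hE
  set s := E.roots with hs
  set sp := s.filter fun r => 0 < r.im with hsp
  set sm := s.filter fun r => ¬ 0 < r.im with hsm
  have hsum : sp + sm = s := Multiset.filter_add_not _ _
  have hsplit := IsAlgClosed.splits E
  have hcard : s.card = 2 * max P.natDegree Q.natDegree := by
    rw [← natDegree_spinDen hPQ, hsplit.natDegree_eq_card_roots]
  have hcard' : sp.card = sm.card := by
    have h1 : sp = (s.filter fun r => ((starRingEnd ℂ) r).im > 0).map (starRingEnd ℂ) := by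
      rw [hsp]
      conv_lhs => rw [hs, ← roots_spinDen_conj P Q, Multiset.filter_map]
      rfl
    rw [h1, Multiset.card_map, hsm]
    congr 1
    refine Multiset.filter_congr fun r hr => ?_
    have := im_ne_zero_of_mem_roots_spinDen hPQ hr
    rw [Complex.conj_im]
    constructor
    · intro h; linarith
    · intro h
      have := lt_of_le_of_ne (not_lt.1 h) this
      linarith
  have hc2 := congrArg Multiset.card hsum
  rw [Multiset.card_add] at hc2
  have hlead : E.leadingCoeff ≠ 0 := leadingCoeff_ne_zero.2 (spinDen_ne_zero hPQ)
  have hmon : ∀ t : Multiset ℂ, (t.map fun r => X - C r).prod.Monic := fun t =>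
    monic_multiset_prod_of_monic _ _ fun r _ => monic_X_sub_C r
  have hdeg : ∀ t : Multiset ℂ, (t.map fun r => X - C r).prod.degree = (t.card : WithBot ℕ) := fun t => by
    rw [degree_eq_natDegree (hmon t).ne_zero, natDegree_multiset_prod_X_sub_C_eq_card]
  -- The leading coefficient goes into `E₋`, so that `E₊` is monic and allows `modByMonic`.
  refine ⟨(sp.map fun r => X - C r).prod, C E.leadingCoeff * (sm.map fun r => X - C r).prod,
    ⟨hPQ, ?_, hmon sp, ?_, ?_, ?_, ?_, ?_, ?_⟩⟩
  · rw [← hE]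
    conv_lhs => rw [hsplit.eq_prod_roots, ← hs, ← hsum, Multiset.map_add, Multiset.prod_add]
    ring
  · rw [hdeg]
    congr 1
    omega
  · rw [degree_C_mul hlead, hdeg]
    congr 1
    omega
  · intro r hr
    rw [roots_multiset_prod_X_sub_C] at hr
    exact (Multiset.mem_filter.1 hr).2
  · intro r hr
    rw [roots_C_mul _ hlead, roots_multiset_prod_X_sub_C] at hr
    obtain ⟨h1, h2⟩ := Multiset.mem_filter.1 hr
    exact lt_of_le_of_ne (not_lt.1 h2) (im_ne_zero_of_mem_roots_spinDen hPQ h1)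
  · exact degree_le_natDegree.trans (by exact_mod_cast le_max_left _ _)
  · exact degree_le_natDegree.trans (by exact_mod_cast le_max_right _ _)

theorem degree_mul_lt {a b : ℂ[X]} {m n : ℕ} (ha : a.degree ≤ m) (hb : b.degree < n) :
    (a * b).degree < ((m + n : ℕ) : WithBot ℕ) := by
  by_cases h0 : b = 0
  · rw [h0, mul_zero, degree_zero]
    exact WithBot.bot_lt_coe _
  · rw [degree_mul]
    rw [degree_eq_natDegree h0] at hb ⊢
    refine (add_le_add_left ha _).trans_lt ?_
    norm_cast at hb ⊢
    omega

theorem eval_ne_zero_of_im_pos {q : ℂ[X]} (hq0 : q ≠ 0) (hq : ∀ r ∈ q.roots, 0 < r.im) {z : ℂ}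
    (hz : z.im ≤ 0) : q.eval z ≠ 0 := fun h =>
  absurd (hq z ((mem_roots hq0).2 h)) (not_lt.2 hz)

theorem eval_ne_zero_of_im_neg {q : ℂ[X]} (hq0 : q ≠ 0) (hq : ∀ r ∈ q.roots, r.im < 0) {z : ℂ}
    (hz : 0 ≤ z.im) : q.eval z ≠ 0 := fun h =>
  absurd (hq z ((mem_roots hq0).2 h)) (not_lt.2 hz)

theorem isCoprime_of_im {p q : ℂ[X]} (hp0 : p ≠ 0) (hq0 : q ≠ 0) (hp : ∀ r ∈ p.roots, r.im < 0)
    (hq : ∀ r ∈ q.roots, 0 < r.im) : IsCoprime p q := by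
  rw [Polynomial.isCoprime_iff_aeval_ne_zero_of_isAlgClosed ℂ ℂ]
  intro z
  rw [coe_aeval_eq_eval]
  rcases le_total z.im 0 with h | h
  · exact Or.inr (eval_ne_zero_of_im_pos hq0 hq h)
  · exact Or.inl (eval_ne_zero_of_im_neg hp0 hp h)

theorem eq_zero_of_ae_eval_eq_zero {p : ℂ[X]} (h : ∀ᵐ x : ℝ, p.eval (x : ℂ) = 0) : p = 0 := by
  have hc : Continuous fun x : ℝ => p.eval (x : ℂ) := p.continuous.comp Complex.continuous_ofReal
  have h1 := (Continuous.ae_eq_iff_eq volume hc (continuous_const (y := (0 : ℂ)))).1 h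
  refine eq_of_eval_ofReal_eq fun x => ?_
  rw [eval_zero]
  exact congrFun h1 x

namespace HalfPlaneFactors

theorem represents_polarPart {P Q Ep Em : ℂ[X]} {M : ℕ} (hf : HalfPlaneFactors P Q Ep Em M)
    (α : ℂ[X]) : Represents hardyᗮ
      (ratVec ((conjPoly P * α) %ₘ Ep) ((conjPoly Q * α) %ₘ Ep) Ep) :=
  represents_hardy_orthogonal_ratVec hf.im_pos (degree_modByMonic_lt _ hf.monic)
    (degree_modByMonic_lt _ hf.monic)

variable {P Q Ep Em : ℂ[X]} {M : ℕ} (hf : HalfPlaneFactors P Q Ep Em M)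

/-- The map sending a polynomial `α` to the polar part `(P̄ α mod E₊, Q̄ α mod E₊) / E₊`. -/
def polarPart : ℂ[X] →ₗ[ℂ] L2 where
  toFun α := (hf.represents_polarPart α).1.toLp _
  map_add' α β := by
    rw [← MemLp.toLp_add]
    apply MemLp.toLp_congr
    refine Filter.Eventually.of_forall fun x => ?_
    ext i
    fin_cases i <;> simp [ratVec, mul_add, add_modByMonic, add_div]
  map_smul' c α := by
    rw [RingHom.id_apply, ← MemLp.toLp_const_smul]
    apply MemLp.toLp_congr
    refine Filter.Eventually.of_forall fun x => ?_
    ext i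
    fin_cases i <;> simp [ratVec, smul_modByMonic, mul_div_assoc]

theorem polarPart_apply (α : ℂ[X]) :
    hf.polarPart α = (hf.represents_polarPart α).1.toLp _ := rfl

theorem polarPart_mem (α : ℂ[X]) : hf.polarPart α ∈ hardyᗮ := (hf.represents_polarPart α).2

theorem polarPart_modByMonic (α : ℂ[X]) : hf.polarPart (α %ₘ Ep) = hf.polarPart α := by
  rw [polarPart_apply, polarPart_apply]
  have h : ∀ q : ℂ[X], (q * (α %ₘ Ep)) %ₘ Ep = (q * α) %ₘ Ep := fun q => by
    rw [← sub_eq_zero, ← sub_modByMonic, modByMonic_eq_zero_iff_dvd hf.monic, ← mul_sub]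
    refine Dvd.dvd.mul_left ⟨-(α /ₘ Ep), ?_⟩ _
    linear_combination modByMonic_add_div α Ep
  apply MemLp.toLp_congr
  rw [h, h]

/-- If `E₊` divides `P̄ α` and `Q̄ α`, then by Bezout for `P̄` and `Q̄` it divides `α`, which has
smaller degree. -/
theorem eq_zero_of_polarPart_eq_zero {α : ℂ[X]} (hα : α.degree < M)
    (h : hf.polarPart α = 0) : α = 0 := by
  have hEp0 := hf.monic.ne_zero
  have h1 := (hf.represents_polarPart α).1.coeFn_toLp
  rw [← hf.polarPart_apply, h] at h1
  have h2 : ∀ᵐ x : ℝ, ratVec ((conjPoly P * α) %ₘ Ep) ((conjPoly Q * α) %ₘ Ep) Ep x = 0 := by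
    filter_upwards [h1, Lp.coeFn_zero C2 2 (volume : Measure ℝ)] with x e1 e2
    rw [← e1, e2]; rfl
  have hx : ∀ x : ℝ, Ep.eval (x : ℂ) ≠ 0 := fun x =>
    eval_ne_zero_of_im_pos hEp0 hf.im_pos (by simp)
  have h3 : (conjPoly P * α) %ₘ Ep = 0 := eq_zero_of_ae_eval_eq_zero (by
    filter_upwards [h2] with x e
    have e' := congrArg (fun y : C2 => y 0) e
    simpa [ratVec, hx] using e')
  have h4 : (conjPoly Q * α) %ₘ Ep = 0 := eq_zero_of_ae_eval_eq_zero (by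
    filter_upwards [h2] with x e
    have e' := congrArg (fun y : C2 => y 1) e
    simpa [ratVec, hx] using e')
  rw [modByMonic_eq_zero_iff_dvd hf.monic] at h3 h4
  obtain ⟨a, b, hab⟩ := isCoprime_conjPoly hf.isCoprime
  refine eq_zero_of_dvd_of_degree_lt (p := Ep) ?_ (by rwa [hf.degree_upper])
  have h5 := dvd_add (h3.mul_left a) (h4.mul_left b)
  have h6 : a * (conjPoly P * α) + b * (conjPoly Q * α) = α := by
    linear_combination α * hab
  rwa [h6] at h5

/-- The map factors through `ℂ[X] / (E₊)`, represented by polynomials of degree less than `M`, and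
is injective there. -/
theorem rank_range_polarPart : Module.rank ℂ (LinearMap.range hf.polarPart) = M := by
  have hr : LinearMap.range hf.polarPart =
      LinearMap.range (hf.polarPart.domRestrict (degreeLT ℂ M)) := by
    apply le_antisymm
    · rintro _ ⟨α, rfl⟩
      refine ⟨⟨α %ₘ Ep, ?_⟩, hf.polarPart_modByMonic α⟩
      rw [mem_degreeLT, ← hf.degree_upper]
      exact degree_modByMonic_lt _ hf.monic
    · rintro _ ⟨α, rfl⟩
      exact ⟨α, rfl⟩
  rw [hr]
  have hinj : Function.Injective (hf.polarPart.domRestrict (degreeLT ℂ M)) := by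
    rw [injective_iff_map_eq_zero]
    rintro ⟨α, hα⟩ h
    exact Subtype.ext (hf.eq_zero_of_polarPart_eq_zero (mem_degreeLT.1 hα) h)
  rw [← (LinearEquiv.ofInjective _ hinj).rank_eq, (degreeLTEquiv ℂ M).rank_eq]
  simp

end HalfPlaneFactors

/-! ### The range of the Hankel operator -/

/-- The operator `Π₋ F` on `L²(ℝ; ℂ²)`. -/
def coProjMul (F : Lp (C2 →L[ℂ] C2) ∞ (volume : Measure ℝ)) : L2 →L[ℂ] L2 :=
  hardyᗮ.subtypeL ∘L hardyᗮ.orthogonalProjectionOnto ∘L mulOp F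

theorem coe_hankel (F : Lp (C2 →L[ℂ] C2) ∞ (volume : Measure ℝ)) (f : hardy) :
    (hankel F f : L2) = coProjMul F f := rfl

theorem coProjMul_eq {F : Lp (C2 →L[ℂ] C2) ∞ (volume : Measure ℝ)} {f g k : L2}
    (hg : g ∈ hardyᗮ) (hk : k ∈ hardy) (h : mulOp F f = g + k) : coProjMul F f = g := by
  have h1 : coProjMul F f = (hardyᗮ.orthogonalProjectionOnto (mulOp F f) : L2) := rfl
  have h2 : hardyᗮ.orthogonalProjectionOnto k = 0 :=
    Submodule.orthogonalProjectionOnto_apply_of_mem_orthogonal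
      (Submodule.le_orthogonal_orthogonal _ hk)
  rw [h1, h, map_add, h2, add_zero]
  exact congrArg Subtype.val
    (Submodule.orthogonalProjectionOnto_mem_subspace_eq_self (⟨g, hg⟩ : hardyᗮ))

/-- `U` is twice the rank-one projection `E⁻¹ (P̄, Q̄)ᵀ (P, Q)` minus the identity. Hence the Hankel
operator depends on `f` only through the scalar `P f₁ + Q f₂`. -/
theorem pauli_mulVec {u : ℝ → S2} {P Q : ℂ[X]} (hs : IsSpinor (fun x => (u x : R3)) P Q)
    (hPQ : IsCoprime P Q) (x : ℝ) (y : C2) :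
    Matrix.toEuclideanCLM (n := Fin 2) (𝕜 := ℂ) (pauli (u x)) y =
      !₂[2 * ((conjPoly P).eval (x : ℂ) * (P.eval (x : ℂ) * y 0 + Q.eval (x : ℂ) * y 1)) /
            (spinDen P Q).eval (x : ℂ) - y 0,
        2 * ((conjPoly Q).eval (x : ℂ) * (P.eval (x : ℂ) * y 0 + Q.eval (x : ℂ) * y 1)) /
            (spinDen P Q).eval (x : ℂ) - y 1] := by
  have h1 := (hs x).1
  have h2 := hs.conj x
  have h3 := (hs x).2
  have hE := spinDen_eval_ne_zero hPQ x
  have hd : (spinDen P Q).eval (x : ℂ) = P.eval (x : ℂ) * (starRingEnd ℂ) (P.eval (x : ℂ)) +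
      Q.eval (x : ℂ) * (starRingEnd ℂ) (Q.eval (x : ℂ)) := by
    simp only [spinDen, eval_add, eval_mul, eval_conjPoly]
  simp only [eval_conjPoly]
  set e := (spinDen P Q).eval (x : ℂ)
  have g : ∀ i, Matrix.toEuclideanCLM (n := Fin 2) (𝕜 := ℂ) (pauli (u x)) y i =
      pauli (u x) i 0 * y 0 + pauli (u x) i 1 * y 1 := fun i => by
    rw [Matrix.ofLp_toEuclideanCLM, Matrix.mulVec, dotProduct, Fin.sum_univ_two]
  ext i
  rw [g]
  apply mul_left_cancel₀ hE
  fin_cases i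
  · simp only [pauli, Fin.zero_eta, Matrix.of_apply, Matrix.cons_val', Matrix.cons_val_zero,
      Matrix.cons_val_one, Matrix.cons_val_fin_one]
    rw [mul_sub, mul_div_cancel₀ _ hE]
    linear_combination y 0 * h3 + y 1 * h2 + y 0 * hd
  · simp only [pauli, Fin.mk_one, Matrix.of_apply, Matrix.cons_val', Matrix.cons_val_zero,
      Matrix.cons_val_one, Matrix.cons_val_fin_one]
    rw [mul_sub, mul_div_cancel₀ _ hE]
    linear_combination y 0 * h1 - y 1 * h3 + y 1 * hd

namespace HalfPlaneFactors

theorem ne_zero_lower {P Q Ep Em : ℂ[X]} {M : ℕ} (hf : HalfPlaneFactors P Q Ep Em M) : Em ≠ 0 := by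
  intro h
  have := hf.degree_lower
  rw [h, degree_zero] at this
  exact WithBot.bot_ne_coe this

/-- The regular part left after removing the polar part has small degree. -/
theorem degree_regular_lt {P Q Ep Em : ℂ[X]} {M : ℕ} (hf : HalfPlaneFactors P Q Ep Em M)
    {T s p q α β : ℂ[X]} {n : ℕ} (hT : T.degree ≤ M) (hq : q.degree = n) (hp : p.degree < n)
    (hs : s.degree < ((M + n : ℕ) : WithBot ℕ)) (hαβ : s = α * (Em * q) + β * Ep) :
    (2 * ((T * α) /ₘ Ep * (Em * q) + T * β) - p * Em).degree < (Em * q).degree := by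
  have hEm := hf.degree_lower
  have hEp := hf.degree_upper
  -- Times `E₊`, this is the numerator of a component of `U f` minus twice the polar part, over the
  -- denominator `E₊ E₋ q`. Both functions vanish at infinity, which bounds the degree by that of
  -- the denominator; `E₊` is then cancelled.
  have e : Ep * (2 * ((T * α) /ₘ Ep * (Em * q) + T * β) - p * Em) =
      2 * (T * s - (Em * q) * ((T * α) %ₘ Ep)) - (Ep * Em) * p := by
    rw [hαβ]
    linear_combination 2 * (Em * q) * modByMonic_add_div (T * α) Ep
  have hEq : (Em * q).degree = ((M + n : ℕ) : WithBot ℕ) := by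
    rw [degree_mul, hEm, hq]; norm_cast
  have hEE : (Ep * Em).degree = ((M + M : ℕ) : WithBot ℕ) := by
    rw [degree_mul, hEm, hEp]; norm_cast
  have d1 : (T * s).degree < ((M + (M + n) : ℕ) : WithBot ℕ) := degree_mul_lt hT hs
  have d2 : ((Em * q) * ((T * α) %ₘ Ep)).degree < ((M + (M + n) : ℕ) : WithBot ℕ) := by
    have := degree_mul_lt hEq.le (n := M) (hEp ▸ degree_modByMonic_lt (T * α) hf.monic)
    rwa [add_comm (M + n) M] at this
  have d3 : ((Ep * Em) * p).degree < ((M + (M + n) : ℕ) : WithBot ℕ) := by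
    have := degree_mul_lt hEE.le hp
    rwa [add_assoc] at this
  have d4 : (2 * (T * s - (Em * q) * ((T * α) %ₘ Ep))).degree <
      ((M + (M + n) : ℕ) : WithBot ℕ) := by
    rw [show (2 : ℂ[X]) = C 2 from rfl, degree_C_mul two_ne_zero]
    exact (degree_sub_le _ _).trans_lt (max_lt d1 d2)
  have d5 := (degree_sub_le _ _).trans_lt (max_lt d4 d3)
  rw [← e, degree_mul, hEp, Nat.cast_add] at d5
  rw [hEq]
  exact lt_of_add_lt_add_left d5

/-- The hypothesis `hαβ` is the partial fraction splitting `(P f₁ + Q f₂) / E = α / E₊ + β / (E₋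
q)`. After multiplication by `P̄` or `Q̄`, the polar part over `E₊` is orthogonal to the Hardy
space. The rest has poles only in the lower half-plane and vanishes at infinity, so the projection
kills it. -/
theorem coProjMul_ratVec {u : ℝ → S2} (hu : IsRational u) {P Q Ep Em : ℂ[X]} {M : ℕ}
    (hf : HalfPlaneFactors P Q Ep Em M) (hs : IsSpinor (fun x => (u x : R3)) P Q)
    {p₁ p₂ q α β : ℂ[X]} (hq : ∀ r ∈ q.roots, r.im < 0) (h₁ : p₁.degree < q.degree)
    (h₂ : p₂.degree < q.degree) (hαβ : P * p₁ + Q * p₂ = α * (Em * q) + β * Ep) {f : L2}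
    (hfv : (f : ℝ → C2) =ᵐ[volume] ratVec p₁ p₂ q) :
    coProjMul (symbol u hu) f = (2 : ℂ) • hf.polarPart α := by
  have hq0 : q ≠ 0 := by rintro rfl; simp at h₁
  have hqn := degree_eq_natDegree hq0
  rw [hqn] at h₁ h₂
  have hdeg : (P * p₁ + Q * p₂).degree < ((M + q.natDegree : ℕ) : WithBot ℕ) :=
    (degree_add_le _ _).trans_lt
      (max_lt (degree_mul_lt hf.degree_left h₁) (degree_mul_lt hf.degree_right h₂))
  have hPc : (conjPoly P).degree ≤ M := by
    rw [conjPoly, degree_map]; exact hf.degree_left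
  have hQc : (conjPoly Q).degree ≤ M := by
    rw [conjPoly, degree_map]; exact hf.degree_right
  have k1 := hf.degree_regular_lt hPc hqn h₁ hdeg hαβ
  have k2 := hf.degree_regular_lt hQc hqn h₂ hdeg hαβ
  have hroots : ∀ r ∈ (Em * q).roots, r.im < 0 := by
    intro r hr
    rw [roots_mul (mul_ne_zero hf.ne_zero_lower hq0), Multiset.mem_add] at hr
    exact hr.elim (hf.im_neg r) (hq r)
  obtain ⟨hk, hk'⟩ := represents_hardy_ratVec hroots k1 k2
  refine coProjMul_eq (hardyᗮ.smul_mem _ (hf.polarPart_mem α)) hk' ?_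
  have hx1 : ∀ x : ℝ, Ep.eval (x : ℂ) ≠ 0 := fun x =>
    eval_ne_zero_of_im_pos hf.monic.ne_zero hf.im_pos (by simp)
  have hx2 : ∀ x : ℝ, Em.eval (x : ℂ) ≠ 0 := fun x =>
    eval_ne_zero_of_im_neg hf.ne_zero_lower hf.im_neg (by simp)
  have hx3 : ∀ x : ℝ, q.eval (x : ℂ) ≠ 0 := fun x =>
    eval_ne_zero_of_im_neg hq0 hq (by simp)
  apply Lp.ext
  filter_upwards [mulOp_toLp_coeFn hu.memLp f, hfv, hk.coeFn_toLp,
    Lp.coeFn_add ((2 : ℂ) • hf.polarPart α) (hk.toLp _), Lp.coeFn_smul (2 : ℂ) (hf.polarPart α),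
    (hf.represents_polarPart α).1.coeFn_toLp] with x e1 e2 e3 e4 e5 e6
  rw [symbol, e1, e4, Pi.add_apply, e5, Pi.smul_apply, e3, polarPart_apply, e6, e2,
    pauli_mulVec hs hf.isCoprime, hf.eq_mul]
  have s1 := congrArg (fun r => r.eval (x : ℂ)) hαβ
  have m1 := congrArg (fun r => r.eval (x : ℂ)) (modByMonic_add_div (conjPoly P * α) Ep)
  have m2 := congrArg (fun r => r.eval (x : ℂ)) (modByMonic_add_div (conjPoly Q * α) Ep)
  simp only [eval_add, eval_mul] at s1 m1 m2
  have hx1 := hx1 x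
  have hx2 := hx2 x
  have hx3 := hx3 x
  ext i
  fin_cases i
  · simp [ratVec]
    field_simp
    linear_combination 2 * (conjPoly P).eval (x : ℂ) * s1 -
      2 * Em.eval (x : ℂ) * q.eval (x : ℂ) * m1
  · simp [ratVec]
    field_simp
    linear_combination 2 * (conjPoly Q).eval (x : ℂ) * s1 -
      2 * Em.eval (x : ℂ) * q.eval (x : ℂ) * m2

theorem isClosed_range_polarPart {P Q Ep Em : ℂ[X]} {M : ℕ} (hf : HalfPlaneFactors P Q Ep Em M) :
    IsClosed (LinearMap.range hf.polarPart : Set L2) := by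
  have : FiniteDimensional ℂ (LinearMap.range hf.polarPart) := by
    rw [FiniteDimensional, ← Module.rank_lt_aleph0_iff, hf.rank_range_polarPart]
    exact Cardinal.natCast_lt_aleph0
  exact Submodule.closed_of_finiteDimensional _

/-- The target is finite-dimensional, hence closed, so Cauchy kernels suffice. For a kernel with
pole `w`, the splitting comes from a Bezout identity for `E₋ (X - w)` and `E₊`, whose zeros lie in
opposite half-planes. -/
theorem coProjMul_mem_range {u : ℝ → S2} (hu : IsRational u) {P Q Ep Em : ℂ[X]} {M : ℕ}
    (hf : HalfPlaneFactors P Q Ep Em M) (hs : IsSpinor (fun x => (u x : R3)) P Q) {f : L2}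
    (hfm : f ∈ hardy) : coProjMul (symbol u hu) f ∈ LinearMap.range hf.polarPart := by
  suffices h : hardy ≤ (LinearMap.range hf.polarPart).comap
      (coProjMul (symbol u hu) : L2 →ₗ[ℂ] L2) from h hfm
  refine (hardy_le_closure_span one_pos).trans (Submodule.topologicalClosure_minimal _
    (Submodule.span_le.2 ?_)
    (hf.isClosed_range_polarPart.preimage (coProjMul (symbol u hu)).continuous))
  rintro g ⟨w, v, hw, hg⟩
  have hroots : ∀ r ∈ (X - C w).roots, r.im < 0 := by
    intro r hr
    rw [roots_X_sub_C, Multiset.mem_singleton] at hr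
    rw [hr, hw]; norm_num
  have hroots' : ∀ r ∈ (Em * (X - C w)).roots, r.im < 0 := by
    intro r hr
    rw [roots_mul (mul_ne_zero hf.ne_zero_lower (X_sub_C_ne_zero w)), Multiset.mem_add] at hr
    exact hr.elim (hf.im_neg r) (hroots r)
  obtain ⟨a, b, hab⟩ := isCoprime_of_im (mul_ne_zero hf.ne_zero_lower (X_sub_C_ne_zero w))
    hf.monic.ne_zero hroots' hf.im_pos
  have hC : ∀ c : ℂ, (C c).degree < (X - C w).degree := fun c => by
    rw [degree_X_sub_C]
    exact degree_C_le.trans_lt (by norm_num)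
  have key := hf.coProjMul_ratVec hu hs (p₁ := C (v 0)) (p₂ := C (v 1))
    (α := (P * C (v 0) + Q * C (v 1)) * a) (β := (P * C (v 0) + Q * C (v 1)) * b) hroots
    (hC _) (hC _) (by linear_combination -(P * C (v 0) + Q * C (v 1)) * hab) (f := g) (by
      filter_upwards [hg] with x hx
      rw [hx]
      ext i
      fin_cases i <;> simp [cauchy, ratVec, div_eq_inv_mul])
  change coProjMul (symbol u hu) g ∈ LinearMap.range hf.polarPart
  rw [key]
  exact Submodule.smul_mem _ _ ⟨_, rfl⟩

/-- One needs `P p₁ + Q p₂ ≡ α E₋ q` modulo `E₊`. With `a P + b Q = 1` and `s` the remainder of the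
right side, `p₁ = a s` and `p₂ = b s` work. -/
theorem polarPart_mem_image {u : ℝ → S2} (hu : IsRational u) {P Q Ep Em : ℂ[X]} {M : ℕ}
    (hf : HalfPlaneFactors P Q Ep Em M) (hs : IsSpinor (fun x => (u x : R3)) P Q) (α : ℂ[X]) :
    ∃ f : hardy, (hankel (symbol u hu) f : L2) = (2 : ℂ) • hf.polarPart α := by
  obtain ⟨a, b, hab⟩ := hf.isCoprime
  -- `q = (X + i)^n` has its zeros in the lower half-plane; `n` is large enough that `a s / q` and
  -- `b s / q` vanish at infinity.
  set n := max a.natDegree b.natDegree + M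
  set q : ℂ[X] := (X - C (-Complex.I)) ^ n with hq
  have hqd : q.degree = n := by rw [hq, degree_pow, degree_X_sub_C]; simp
  have hroots : ∀ r ∈ q.roots, r.im < 0 := by
    intro r hr
    rw [hq, roots_pow, roots_X_sub_C] at hr
    have := Multiset.mem_of_mem_nsmul hr
    rw [Multiset.mem_singleton] at this
    simp [this]
  set s := (α * (Em * q)) %ₘ Ep
  have hsd : s.degree < M := by
    rw [← hf.degree_upper]; exact degree_modByMonic_lt _ hf.monic
  have hd : ∀ c : ℂ[X], c.natDegree ≤ max a.natDegree b.natDegree →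
      (c * s).degree < q.degree := fun c hc => by
    rw [hqd]
    exact degree_mul_lt (degree_le_of_natDegree_le hc) hsd
  obtain ⟨hr, hr'⟩ := represents_hardy_ratVec hroots (hd a (le_max_left _ _))
    (hd b (le_max_right _ _))
  refine ⟨⟨_, hr'⟩, ?_⟩
  rw [coe_hankel]
  exact hf.coProjMul_ratVec hu hs (β := -((α * (Em * q)) /ₘ Ep)) hroots (hd a (le_max_left _ _))
    (hd b (le_max_right _ _))
    (by linear_combination s * hab + modByMonic_add_div (α * (Em * q)) Ep) hr.coeFn_toLp

theorem map_range_hankel {u : ℝ → S2} (hu : IsRational u) {P Q Ep Em : ℂ[X]} {M : ℕ}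
    (hf : HalfPlaneFactors P Q Ep Em M) (hs : IsSpinor (fun x => (u x : R3)) P Q) :
    (LinearMap.range (hankel (symbol u hu) : hardy →ₗ[ℂ] hardyᗮ)).map hardyᗮ.subtype =
      LinearMap.range hf.polarPart := by
  apply le_antisymm
  · rintro _ ⟨_, ⟨f, rfl⟩, rfl⟩
    exact hf.coProjMul_mem_range hu hs f.2
  · rintro _ ⟨α, rfl⟩
    obtain ⟨f, h⟩ := hf.polarPart_mem_image hu hs ((2 : ℂ)⁻¹ • α)
    refine ⟨_, ⟨f, rfl⟩, ?_⟩
    rw [map_smul, smul_smul, mul_inv_cancel₀ two_ne_zero, one_smul] at h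
    exact h

end HalfPlaneFactors

/-! ### Ranks of `H_U` and `K_U` -/

theorem rank_hankel {u : ℝ → S2} (hu : IsRational u) {P Q : ℂ[X]} (hPQ : IsCoprime P Q)
    (hs : IsSpinor (fun x => (u x : R3)) P Q) :
    LinearMap.rank (hankel (symbol u hu) : hardy →ₗ[ℂ] hardyᗮ) =
      (max P.natDegree Q.natDegree : ℕ) := by
  obtain ⟨Ep, Em, hf⟩ := exists_halfPlaneFactors hPQ
  rw [← hf.rank_range_polarPart, ← hf.map_range_hankel hu hs]
  exact (Submodule.equivMapOfInjective _ hardyᗮ.injective_subtype _).rank_eq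

/-- `H^* H` and `H` have the same kernel, so both ranges are isomorphic to the same quotient. -/
theorem rank_opK (F : Lp (C2 →L[ℂ] C2) ∞ (volume : Measure ℝ)) :
    LinearMap.rank (opK F : hardy →ₗ[ℂ] hardy) =
      LinearMap.rank (hankel F : hardy →ₗ[ℂ] hardyᗮ) := by
  have hker : LinearMap.ker (opK F : hardy →ₗ[ℂ] hardy) =
      LinearMap.ker (hankel F : hardy →ₗ[ℂ] hardyᗮ) :=
    ContinuousLinearMap.ker_adjoint_comp_self (hankel F)
  have h1 := (LinearMap.quotKerEquivRange (opK F : hardy →ₗ[ℂ] hardy)).rank_eq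
  have h2 := (LinearMap.quotKerEquivRange (hankel F : hardy →ₗ[ℂ] hardyᗮ)).rank_eq
  rw [hker] at h1
  exact h1.symm.trans h2

theorem rank_h1 {F : Lp (C2 →L[ℂ] C2) ∞ (volume : Measure ℝ)} {M : ℕ}
    (h : LinearMap.rank (opK F : hardy →ₗ[ℂ] hardy) = M) : Module.rank ℂ (h1 F) = M := by
  have : FiniteDimensional ℂ (LinearMap.range (opK F : hardy →ₗ[ℂ] hardy)) := by
    rw [FiniteDimensional, ← Module.rank_lt_aleph0_iff]
    exact lt_of_eq_of_lt h Cardinal.natCast_lt_aleph0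
  have hc : h1 F = LinearMap.range (opK F : hardy →ₗ[ℂ] hardy) :=
    (Submodule.closed_of_finiteDimensional _).submodule_topologicalClosure_eq
  rw [hc]
  exact h

theorem isStereographicImage_iff (u : ℝ → S2) {N : ℕ} (hN : 1 ≤ N) :
    IsStereographicImage u N ↔ ∃ P Q : ℂ[X], P.degree = N ∧ Q.degree < N ∧ IsCoprime P Q ∧
      ∃ A ∈ Matrix.specialOrthogonalGroup (Fin 3) ℝ,
        IsSpinor (fun x => Matrix.toEuclideanCLM (n := Fin 3) (𝕜 := ℝ) A (u x)) P Q := by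
  constructor
  · rintro ⟨R, P, Q, rfl, hP, hQ0, hQ, hPQ, A, hA, h⟩
    exact ⟨P, Q, hP, hQ, hPQ, A, hA, (isSpinor_iff_eq_invStereo hPQ hQ0 _).2 h⟩
  · rintro ⟨P, Q, hP, hQ, hPQ, A, hA, h⟩
    have hQ0 : Q ≠ 0 := by
      -- If `Q = 0`, coprimality makes `P` a unit, of degree 0, contrary to `N ≥ 1`.
      rintro rfl
      have := degree_eq_zero_of_isUnit (isCoprime_zero_right.1 hPQ)
      rw [hP] at this
      norm_cast at this
      omega
    exact ⟨_, P, Q, rfl, hP, hQ0, hQ, hPQ, A, hA, (isSpinor_iff_eq_invStereo hPQ hQ0 _).1 h⟩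

end HalfWave

end

open HalfWave in
theorem mainTheorem8 (u : ℝ → HalfWave.S2) (hu : HalfWave.IsRational u) (N : ℕ) (hN : 1 ≤ N) :
    List.TFAE [
      Module.rank ℂ (HalfWave.h1 (HalfWave.symbol u hu)) = N ∧
        LinearMap.rank (HalfWave.opK (HalfWave.symbol u hu) :
          HalfWave.hardy →ₗ[ℂ] HalfWave.hardy) = N,
      ∃ D : ℝ[X], HalfWave.IsLeastCommonDenominator u D ∧ D.natDegree = 2 * N,
      HalfWave.IsStereographicImage u N] := by
  obtain ⟨P, Q, hPQ, hs⟩ := exists_isSpinor hu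
  have hrank := (rank_opK (symbol u hu)).trans (rank_hankel hu hPQ hs)
  -- No rotation is needed here: the spinor `(P, Q)` belongs to `u` itself.
  obtain ⟨E, hE, hEd⟩ := exists_isLeastCommonDenominator (u := u) (A := 1) (B := 1) (one_mul 1) hPQ
    (by simpa only [map_one, one_apply_eq_self] using hs)
  tfae_have 1 → 2 := fun h => by
    have h1 := hrank.symm.trans h.2
    norm_cast at h1
    exact ⟨E, hE, by rw [hEd, h1]⟩
  tfae_have 2 → 1 := by
    rintro ⟨D, hD, hDd⟩
    have h1 : max P.natDegree Q.natDegree = N := by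
      have := hD.natDegree_eq hE
      omega
    rw [h1] at hrank
    exact ⟨rank_h1 hrank, hrank⟩
  tfae_have 2 → 3 := by
    rintro ⟨D, hD, hDd⟩
    have h1 : max P.natDegree Q.natDegree = N := by
      have := hD.natDegree_eq hE
      omega
    obtain ⟨A, hA, P', Q', hPQ', hP', hQ', h⟩ := hs.exists_rot hPQ
    rw [h1] at hP' hQ'
    exact (isStereographicImage_iff u hN).2 ⟨P', Q', hP', hQ', hPQ', A, hA, h⟩
  tfae_have 3 → 2 := fun h => by
    obtain ⟨P', Q', hP', hQ', hPQ', A, hA, h⟩ := (isStereographicImage_iff u hN).1 h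
    -- The transpose is the left inverse that carries the denominator of `A u` back to `u`.
    have hA' := (Matrix.mem_orthogonalGroup_iff' (Fin 3) ℝ).1
      (Matrix.mem_specialOrthogonalGroup_iff.1 hA).1
    obtain ⟨D, hD, hDd⟩ := exists_isLeastCommonDenominator hA' hPQ' h
    refine ⟨D, hD, ?_⟩
    rw [hDd, natDegree_eq_of_degree_eq_some hP', max_eq_left]
    exact natDegree_le_of_degree_le hQ'.le
  tfae_finish
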